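/- Let $\mathbb{K}$ be a field and $n\ge 0$. An $(s,m)$-table ($0\le s<m$) consists of non-negative integers $d_j=\alpha_{0,j}$ ($1\le j\le m$) and $\alpha_{i,j}$ ($1\le i\le s$, $1\le j\le m$) such that $\alpha_{i,j}=0$ for $i>j$; $\sum_{i=1}^s\alpha_{i,j}\le d_j$ for all $j$; and $d_k=\sum_{i=1}^{k-1}\alpha_{i,k}+\sum_{j=k+1}^m\alpha_{k,j}+\alpha_{k+1,k+1}$ for $1\le k\le s$, where $\alpha_{s+1,s+1}:=0$. Columns $1,\dots,s$ are called constrained, the others unconstrained. If the columns are labelled by distinct variables $y_1,\dots,y_m$, the ideal of the table is generated by the monomials $$m_{i,j}=\prod_{t\in\{1,\dots,i\}\cup\{j\}}y_t^{\,d_t-\alpha_{1,t}-\cdots-\alpha_{i,t}}\qquad(0\le i\le s,\ i<j\le m).$$ A generalised table $T$ in $x_1,\dots,x_n$ is a finite disjoint union of tables whose columns are labelled by the variables $x_1,\dots,x_n$, each variable labelling exactly one column of exactly one table; $K(T)\subseteq\mathbb{K}[x_1,\dots,x_n]$ is the sum of the (extended) ideals of its tables. Generalised tables are identified if they differ by a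 permutation of the individual tables, by permutations of the unconstrained columns (with their labels) within tables, or by replacing a $(0,m)$-table by the corresponding $m$ $(0,1)$-tables. A table ideal is an ideal of the form $K(T)$. A (generalised) table is proper if its ideal is not the whole polynomial ring. A proper $(s,m)$-table is in normal form if $s=0$, or if $s\ge1$ and: $\alpha_{i,i}\ne0$ for $1\le i\le s$; for each $j>s$ some $\alpha_{i,j}$ with $1\le i\le s$ is nonzero; and $\sum_{i=1}^s\alpha_{i,j}<d_j$ for all $j$. A proper generalised table is in normal form if each of its tables is. **Theorem.** Let $K\subsetneq\mathbb{K}[x_1,\dots,x_n]$ be a proper table ideal. Then there is a generalised table $T$ in $x_1,\dots,x_n$ in normal form with $K=K(T)$, and it is unique up to the identifications above. -/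

import Mathlib

/-- An `(s,n)`-table, `0 ≤ s < n`: an `(s+1) × n` matrix of natural numbers whose row `0` is
`d` and whose rows `1, …, s` are `α`. Rows of `α` and columns are indexed from `0`, so the
diagonal entries `α_{1,1}, …, α_{s,s}` are `α k k` for `k = 0, …, s - 1`. The columns `j` with
`j < s` are the constrained ones. -/
structure Table (s n : ℕ) where
  lt : s < n
  d : Fin n → ℕ
  α : Matrix (Fin s) (Fin n) ℕ
  /-- `α_{i,j} = 0` for `i > j`. -/
  lower_zero : ∀ (i : Fin s) (j : Fin n), (j : ℕ) < i → α i j = 0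
  /-- `∑_i α_{i,j} ≤ d_j`. -/
  col_le : ∀ j : Fin n, ∑ i, α i j ≤ d j
  /-- `d_k = ∑_{i<k} α_{i,k} + ∑_{j>k} α_{k,j} + α_{k+1,k+1}` for every constrained column `k`,
  where the last diagonal term is `0` if row `k+1` does not exist. -/
  constraint : ∀ k : Fin s,
    d (Fin.castLE lt.le k) =
      (∑ i ∈ Finset.univ.filter (fun i : Fin s => i < k), α i (Fin.castLE lt.le k))
      + (∑ j ∈ Finset.univ.filter (fun j : Fin n => (k : ℕ) < j), α k j)
      + (if h : (k : ℕ) + 1 < s then α ⟨k + 1, h⟩ ⟨k + 1, h.trans lt⟩ else 0)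

namespace Table

variable {s n : ℕ}

/-- `d_t - α_{1,t} - ⋯ - α_{i,t}`: the entry in row `0` of column `t` minus the entries in the
rows `1, …, i`. By `col_le` the subtraction is never truncated. -/
def expo (T : Table s n) (i : Fin (s + 1)) (t : Fin n) : ℕ :=
  T.d t - ∑ r ∈ Finset.univ.filter (fun r : Fin s => (r : ℕ) < i), T.α r t

/-- The monomial `m_{i,j}`, the product of `x_t ^ (d_t - α_{1,t} - ⋯ - α_{i,t})` over the first
`i` columns `t` and `t = j`. -/
noncomputable def gen (𝕜 : Type*) [Field 𝕜] (T : Table s n) (i : Fin (s + 1)) (j : Fin n) :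
    MvPolynomial (Fin n) 𝕜 :=
  ∏ t ∈ Finset.univ.filter (fun t : Fin n => (t : ℕ) < i ∨ t = j),
    MvPolynomial.X t ^ T.expo i t

/-- `K(T)`, generated by all `m_{i,j}` with `0 ≤ i ≤ s` and column `j` to the right of the first
`i` columns. -/
noncomputable def ideal (𝕜 : Type*) [Field 𝕜] (T : Table s n) : Ideal (MvPolynomial (Fin n) 𝕜) :=
  Ideal.span {f | ∃ (i : Fin (s + 1)) (j : Fin n), (i : ℕ) ≤ j ∧ f = T.gen 𝕜 i j}

/-- A table is proper if its ideal is not the whole polynomial ring. -/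
def IsProper (𝕜 : Type*) [Field 𝕜] (T : Table s n) : Prop :=
  T.ideal 𝕜 ≠ ⊤

/-- Normal form of a single table. For `s = 0` only properness is required. -/
structure IsNormal (𝕜 : Type*) [Field 𝕜] (T : Table s n) : Prop where
  proper : T.IsProper 𝕜
  diag_ne_zero : ∀ i : Fin s, T.α i (Fin.castLE T.lt.le i) ≠ 0
  no_zero_column : 1 ≤ s → ∀ j : Fin n, s ≤ (j : ℕ) → ∃ i : Fin s, T.α i j ≠ 0
  no_singularity : 1 ≤ s → ∀ j : Fin n, ∑ i, T.α i j < T.d j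

/-- The `(0,1)`-table with single entry `d`. -/
def single (d : ℕ) : Table 0 1 where
  lt := Nat.zero_lt_one
  d := fun _ => d
  α := fun i => i.elim0
  lower_zero := fun i => i.elim0
  col_le := fun _ => by simp
  constraint := fun k => k.elim0

end Table

/-- A table whose columns are labelled by pairwise distinct variables from `σ`. -/
structure LabelledTable (σ : Type*) where
  s : ℕ
  n : ℕ
  table : Table s n
  var : Fin n ↪ σ

namespace LabelledTable

variable {σ : Type*}

/-- The ideal generated by `K(T)`, written in the labelling variables, in the polynomial ring in
all the variables of `σ`. -/
noncomputable def ideal (𝕜 : Type*) [Field 𝕜] (A : LabelledTable σ) : Ideal (MvPolynomial σ 𝕜) :=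
  (A.table.ideal 𝕜).map (MvPolynomial.rename A.var)

/-- The `(0,1)`-table with entry `d` in the variable `v`. -/
def single (d : ℕ) (v : σ) : LabelledTable σ where
  s := 0
  n := 1
  table := Table.single d
  var := ⟨fun _ => v, fun _ _ _ => Subsingleton.elim _ _⟩

/-- Two labelled tables that differ by a permutation of the unconstrained columns, moved together
with their labels. -/
def Same (A B : LabelledTable σ) : Prop :=
  ∃ (hs : A.s = B.s) (e : Fin A.n ≃ Fin B.n),
    (∀ j : Fin A.n, (j : ℕ) < A.s → (e j : ℕ) = j) ∧
    (∀ j : Fin A.n, B.table.d (e j) = A.table.d j) ∧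
    (∀ (i : Fin A.s) (j : Fin A.n), B.table.α (Fin.cast hs i) (e j) = A.table.α i j) ∧
    (∀ j : Fin A.n, B.var (e j) = A.var j)

/-- A `(0,n)`-table is the disjoint union of `n` tables of type `(0,1)`; a table with at least one
constrained column stays as it is. -/
def split (A : LabelledTable σ) : Multiset (LabelledTable σ) :=
  if A.s = 0 then
    (Finset.univ : Finset (Fin A.n)).val.map (fun j => single (A.table.d j) (A.var j))
  else {A}

end LabelledTable

/-- A generalised table in the variables `σ`: a finite family of tables, without order, such that
every variable labels exactly one column of exactly one of the tables. -/
structure GenTable (σ : Type*) [Fintype σ] where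
  tables : Multiset (LabelledTable σ)
  partition : tables.bind (fun A => (Finset.univ : Finset (Fin A.n)).val.map A.var)
    = (Finset.univ : Finset σ).val

namespace GenTable

variable {σ : Type*} [Fintype σ]

/-- `K(T)`: the sum of the ideals of the individual tables. -/
noncomputable def ideal (𝕜 : Type*) [Field 𝕜] (T : GenTable σ) : Ideal (MvPolynomial σ 𝕜) :=
  (T.tables.map (LabelledTable.ideal 𝕜)).sum

/-- A generalised table is proper if its ideal is not the whole polynomial ring. -/
def IsProper (𝕜 : Type*) [Field 𝕜] (T : GenTable σ) : Prop :=
  T.ideal 𝕜 ≠ ⊤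

/-- A proper generalised table is in normal form if all its tables are. -/
def IsNormal (𝕜 : Type*) [Field 𝕜] (T : GenTable σ) : Prop :=
  T.IsProper 𝕜 ∧ ∀ A ∈ T.tables, A.table.IsNormal 𝕜

/-- The individual tables, each `(0,n)`-table being regarded as `n` tables of type `(0,1)`. -/
def components (T : GenTable σ) : Multiset (LabelledTable σ) :=
  T.tables.bind LabelledTable.split

/-- Two generalised tables are not distinguished if, after every `(0,n)`-table is regarded as a
union of `n` tables of type `(0,1)`, they differ by a permutation of the individual tables and of
the unconstrained columns inside the tables. -/
def Same (T T' : GenTable σ) : Prop :=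
  Multiset.Rel LabelledTable.Same T.components T'.components

end GenTable

/-- An ideal of the form `K(T)` for a generalised table `T` in the variables `σ`. -/
def IsTableIdeal {𝕜 : Type*} [Field 𝕜] {σ : Type*} [Fintype σ] (K : Ideal (MvPolynomial σ 𝕜)) :
    Prop :=
  ∃ T : GenTable σ, T.ideal 𝕜 = K

/-! Deleting the first row and the first column of a table leaves a table. So a table is a top row
d, a first constrained variable v with final exponent f = d_v - α_{1,1}, and a tail R with top row
d_t - α_{1,t}; its ideal is generated by the powers x_t^{d_t} together with x_v^f K(R). Everything
is an induction along this recursion.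

Existence: normalise the tail first. If its ideal is (1), only pure powers remain. Otherwise f = d_v
makes the tail superfluous, and f = 0 turns v into an unconstrained zero column of the tail. Each
replacement lowers no bound that the row above relies on: the top row does not grow, and its sum
minus the first diagonal entry, the only quantity in the constraint above, is unchanged
(`exists_reduced_or_base`). Finally the unconstrained zero columns split off as (0,1)-tables.

Uniqueness: call a monomial of the ideal mixed if no x_t^{d_t} divides it. The pure powers determine
d. Every mixed monomial is divisible by x_v^f, and f is the least exponent of v that occurs. The
constraints force d_v < d_c for any other variable c dividing all mixed monomials
(`d_lt_of_common`), so two candidates for v would each have the larger entry. Fixing the exponent of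
v at f recovers the tail, whence `eqv_of_mem_iff`. In a disjoint union, each variable of a table
without zero columns is indispensable in some mixed monomial, and so is v. Hence the variables of
one table stay together in every normal form of the ideal (`exists_vars_subset`), the partition is
determined, and monomials supported on one block reduce the claim to a single table. -/

/-- A table in recursive form: the top row `d`, and unless there are no constrained columns, the
first constrained variable `v`, its final exponent `f`, and the table in the remaining variables
obtained by deleting the first row and the first column. -/
inductive TableChain (σ : Type*) where
  | base (d : σ → ℕ) : TableChain σ
  | cons (d : σ → ℕ) (v : σ) (f : ℕ) (R : TableChain σ) : TableChain σ

/-! ### Tables in recursive form: axioms, reducedness, membership -/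

namespace TableChain

variable {σ : Type*}

/-- The top row. -/
def d : TableChain σ → σ → ℕ
  | base d => d
  | cons d _ _ _ => d

/-- The first diagonal entry, `0` if there is none. -/
def lead : TableChain σ → ℕ
  | base _ => 0
  | cons d v f _ => d v - f

@[simp] theorem d_base (d : σ → ℕ) : (base d).d = d := rfl

@[simp] theorem d_cons (d : σ → ℕ) (v : σ) (f : ℕ) (R : TableChain σ) : (cons d v f R).d = d := rfl

@[simp] theorem lead_base (d : σ → ℕ) : (base d).lead = 0 := rfl

@[simp] theorem lead_cons (d : σ → ℕ) (v : σ) (f : ℕ) (R : TableChain σ) :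
    (cons d v f R).lead = d v - f := rfl

/-- There is at least one constrained column. -/
def IsCons : TableChain σ → Prop
  | base _ => False
  | cons _ _ _ _ => True

/-- `t` labels an unconstrained column which vanishes below the top row. -/
def IsZeroColumn : TableChain σ → σ → Prop
  | base _, _ => True
  | cons d v _ R, t => t ≠ v ∧ R.d t = d t ∧ R.IsZeroColumn t

/-- Adds an unconstrained zero column with label `v` and top entry `e`. -/
def addColumn [DecidableEq σ] (v : σ) (e : ℕ) : TableChain σ → TableChain σ
  | base d => base (Function.update d v e)
  | cons d w f R => cons (Function.update d v e) w f (R.addColumn v e)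

variable [DecidableEq σ]

/-- The exponents of the monomials in the ideal of the table. -/
def Mem : Finset σ → TableChain σ → (σ → ℕ) → Prop
  | V, base d, u => ∃ t ∈ V, d t ≤ u t
  -- For i ≥ 1 the generator m_{i,j} is x_v^f times a generator of the tail.
  | V, cons d v f R, u => (∃ t ∈ V, d t ≤ u t) ∨ (f ≤ u v ∧ R.Mem (V.erase v) u)

/-- The axioms of a table with variables `V`. -/
def Valid : Finset σ → TableChain σ → Prop
  | V, base _ => V.Nonempty
  | V, cons d v f R => v ∈ V ∧ f ≤ d v ∧ (∀ t ∈ V.erase v, R.d t ≤ d t) ∧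
      -- The constraint of the first column, with α_{1,t} = d_t - R.d t and no subtraction.
      d v + ∑ t ∈ V.erase v, R.d t = ∑ t ∈ V.erase v, d t + R.lead ∧ R.Valid (V.erase v)

/-- Normal form, except that zero columns are allowed. -/
def Reduced : Finset σ → TableChain σ → Prop
  | V, base d => ∀ t ∈ V, 0 < d t
  -- 0 < f says that column v is not exhausted by its α, and f < d v that its diagonal entry is
  -- nonzero.
  | V, cons d v f R => 0 < f ∧ f < d v ∧ R.Reduced (V.erase v)

/-- Equality of tables with variables `V`. -/
def Eqv : Finset σ → TableChain σ → TableChain σ → Prop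
  | V, base d, base d' => ∀ t ∈ V, d t = d' t
  | V, cons d v f R, cons d' v' f' R' =>
      (∀ t ∈ V, d t = d' t) ∧ v = v' ∧ f = f' ∧ R.Eqv (V.erase v) R'
  | _, _, _ => False

variable {V W : Finset σ} {R R' : TableChain σ} {u w : σ → ℕ}

theorem mem_of_d_le {t : σ} (ht : t ∈ V) (h : R.d t ≤ u t) : R.Mem V u := by
  cases R with
  | base d => exact ⟨t, ht, h⟩
  | cons d v f R => exact Or.inl ⟨t, ht, h⟩

theorem Valid.nonempty (h : R.Valid V) : V.Nonempty := by
  cases R with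
  | base d => exact h
  | cons d v f R => exact ⟨v, h.1⟩

theorem Mem.congr (hv : R.Valid V) (h : R.Mem V u) (huw : ∀ t ∈ V, u t ≤ w t) : R.Mem V w := by
  induction R generalizing V with
  | base d =>
    obtain ⟨t, ht, h⟩ := h
    exact ⟨t, ht, h.trans (huw t ht)⟩
  | cons d v f R ih =>
    rcases h with ⟨t, ht, h⟩ | ⟨h1, h2⟩
    · exact Or.inl ⟨t, ht, h.trans (huw t ht)⟩
    · exact Or.inr ⟨h1.trans (huw v hv.1), ih hv.2.2.2.2 h2 fun t ht =>
        huw t (Finset.mem_of_mem_erase ht)⟩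

theorem mem_update_iff {v : σ} {k : ℕ} (hv : R.Valid V) (h : v ∉ V) :
    R.Mem V (Function.update u v k) ↔ R.Mem V u := by
  have key : ∀ t ∈ V, Function.update u v k t = u t := fun t ht =>
    Function.update_of_ne (ne_of_mem_of_not_mem ht h) _ _
  exact ⟨fun h => h.congr hv fun t ht => (key t ht).le,
    fun h => h.congr hv fun t ht => (key t ht).ge⟩

theorem Reduced.d_pos (hv : R.Valid V) (h : R.Reduced V) : ∀ t ∈ V, 0 < R.d t := by
  induction R generalizing V with
  | base d => exact h
  | cons d v f R ih =>
    intro t ht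
    by_cases e : t = v
    · subst e
      exact h.1.trans h.2.1
    · have ht' := Finset.mem_erase.2 ⟨e, ht⟩
      exact (ih hv.2.2.2.2 h.2.2 t ht').trans_le (hv.2.2.1 t ht')

/-- All exponents in the generators are positive, so a monomial free of the variables in V is in no
reduced ideal. This keeps the tables of a disjoint union apart. -/
theorem Reduced.not_mem_zero (hv : R.Valid V) (h : R.Reduced V) (hu : ∀ t ∈ V, u t = 0) :
    ¬ R.Mem V u := by
  cases R with
  | base d =>
    rintro ⟨t, ht, h'⟩
    have := h t ht
    have := hu t ht
    omega
  | cons d v f R =>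
    rintro (⟨t, ht, h'⟩ | ⟨h1, -⟩)
    · have := Reduced.d_pos hv h t ht
      have := hu t ht
      simp only [d_cons] at *
      omega
    · have := hu v hv.1
      have := h.1
      omega

/-! ### Existence of reduced tables -/

theorem addColumn_d (v : σ) (e : ℕ) : (R.addColumn v e).d = Function.update R.d v e := by
  cases R <;> rfl

theorem addColumn_lead {v : σ} {e : ℕ} (hv : R.Valid V) (h : v ∉ V) :
    (R.addColumn v e).lead = R.lead := by
  cases R with
  | base d => rfl
  | cons d w f R =>
    have : w ≠ v := fun e => h (e ▸ hv.1)
    simp [addColumn, lead, this]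

/-- In a zero column the exponent stays e in every row, so the only new generator that matters is
the pure power x_v^e. -/
theorem mem_addColumn_iff {v : σ} {e : ℕ} (hv : R.Valid V) (h : v ∉ V) :
    (R.addColumn v e).Mem (insert v V) u ↔ e ≤ u v ∨ R.Mem V u := by
  have key : ∀ d : σ → ℕ, (∃ t ∈ insert v V, Function.update d v e t ≤ u t) ↔
      (e ≤ u v ∨ ∃ t ∈ V, d t ≤ u t) := by
    intro d
    rw [Finset.exists_mem_insert, Function.update_self]
    refine or_congr_right (exists_congr fun t => and_congr_right fun ht => ?_)
    rw [Function.update_of_ne (ne_of_mem_of_not_mem ht h)]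
  have prop : ∀ a b c d : Prop, (a ∨ b) ∨ c ∧ (a ∨ d) ↔ a ∨ b ∨ c ∧ d := by tauto
  induction R generalizing V with
  | base d => exact key d
  | cons d w f R ih =>
    have hne : w ≠ v := fun e => h (e ▸ hv.1)
    have hv' : v ∉ V.erase w := fun h' => h (Finset.mem_of_mem_erase h')
    have := ih hv.2.2.2.2 hv' (by
      intro d
      rw [Finset.exists_mem_insert, Function.update_self]
      refine or_congr_right (exists_congr fun t => and_congr_right fun ht => ?_)
      rw [Function.update_of_ne (ne_of_mem_of_not_mem ht hv')])
    simp only [addColumn, Mem, key, Finset.erase_insert_of_ne hne.symm, this, prop]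

theorem Valid.addColumn {v : σ} {e : ℕ} (hv : R.Valid V) (h : v ∉ V) :
    (R.addColumn v e).Valid (insert v V) := by
  induction R generalizing V with
  | base d => exact Finset.insert_nonempty _ _
  | cons d w f R ih =>
    have hne : w ≠ v := fun e => h (e ▸ hv.1)
    have hv' : v ∉ V.erase w := fun h' => h (Finset.mem_of_mem_erase h')
    have key : ∀ d : σ → ℕ, ∑ t ∈ V.erase w, Function.update d v e t = ∑ t ∈ V.erase w, d t :=
      fun d => Finset.sum_congr rfl fun t ht =>
        Function.update_of_ne (ne_of_mem_of_not_mem ht hv') _ _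
    obtain ⟨h1, h2, h3, h4, h5⟩ := hv
    simp only [TableChain.addColumn, Valid, Finset.erase_insert_of_ne hne.symm, addColumn_d,
      Finset.sum_insert hv', key, Function.update_self, Function.update_of_ne hne,
      addColumn_lead h5 hv']
    refine ⟨Finset.mem_insert_of_mem h1, h2, ?_, by omega, ih h5 hv'⟩
    intro t ht
    rcases Finset.mem_insert.1 ht with rfl | ht
    · simp
    · have : t ≠ v := fun e => hv' (e ▸ ht)
      simpa [this] using h3 t ht

theorem Reduced.addColumn {v : σ} {e : ℕ} (hv : R.Valid V) (h : v ∉ V) (he : 0 < e)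
    (hr : R.Reduced V) : (R.addColumn v e).Reduced (insert v V) := by
  induction R generalizing V with
  | base d =>
    intro t ht
    by_cases htv : t = v
    · subst htv
      simpa using he
    · simpa [htv] using hr t (Finset.mem_of_mem_insert_of_ne ht htv)
  | cons d w f R ih =>
    have hne : w ≠ v := fun e => h (e ▸ hv.1)
    have hv' : v ∉ V.erase w := fun h' => h (Finset.mem_of_mem_erase h')
    simp only [TableChain.addColumn, Reduced, Finset.erase_insert_of_ne hne.symm,
      Function.update_of_ne hne]
    exact ⟨hr.1, hr.2.1, ih hv.2.2.2.2 hv' hr.2.2⟩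

/-- The bound on the top row and the identity for sums strengthen the induction: they let the new
tail replace the old one under the same first row. The second alternative is the unit ideal. -/
theorem exists_reduced_or_base (hv : R.Valid V) :
    ∃ R' : TableChain σ, R'.Valid V ∧ (∀ u, R'.Mem V u ↔ R.Mem V u) ∧
      (∀ t ∈ V, R'.d t ≤ R.d t) ∧
      ∑ t ∈ V, R'.d t + R.lead = ∑ t ∈ V, R.d t + R'.lead ∧
      (R'.Reduced V ∨ ∃ d, R' = base d ∧ ∃ t ∈ V, d t = 0) := by
  have hbase : ∀ (V : Finset σ) (d : σ → ℕ),
      (base d).Reduced V ∨ ∃ d', base d = base d' ∧ ∃ t ∈ V, d' t = 0 := by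
    intro V d
    by_cases h : ∃ t ∈ V, d t = 0
    · exact Or.inr ⟨d, rfl, h⟩
    · push Not at h
      exact Or.inl fun t ht => Nat.pos_of_ne_zero (h t ht)
  induction R generalizing V with
  | base d => exact ⟨base d, hv, fun _ => Iff.rfl, fun _ _ => le_rfl, rfl, hbase V d⟩
  | cons d v f R ih =>
    obtain ⟨h1, h2, h3, h4, h5⟩ := hv
    obtain ⟨S, hS, hmem, hle, hsum, hred⟩ := ih h5
    have hSle : ∀ t ∈ V.erase v, S.d t ≤ d t := fun t ht => (hle t ht).trans (h3 t ht)
    have hSsum : d v + ∑ t ∈ V.erase v, S.d t = ∑ t ∈ V.erase v, d t + S.lead := by omega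
    have hsplit : ∀ g : σ → ℕ, ∑ t ∈ V, g t = g v + ∑ t ∈ V.erase v, g t := fun g =>
      (Finset.add_sum_erase V g h1).symm
    have hmem' : ∀ u, (cons d v f R).Mem V u ↔ (cons d v f S).Mem V u := by
      intro u
      simp only [Mem, hmem]
    simp only [hmem']
    have hupd : ∀ t ∈ V.erase v, Function.update d v f t = d t := fun t ht =>
      Function.update_of_ne (Finset.ne_of_mem_erase ht) _ _
    rcases hred with hred | ⟨e, rfl, t, ht, het⟩
    -- If f = d v, every generator from the tail is a multiple of x_v^{d_v}, so the top row alone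
    -- suffices.
    · by_cases hfd : f = d v
      · refine ⟨base d, ⟨v, h1⟩, ?_, fun _ _ => le_rfl, by simp [lead, TableChain.d, hfd],
          hbase V d⟩
        intro u
        simp only [Mem]
        exact ⟨Or.inl, fun h => h.elim id fun h => ⟨v, h1, hfd ▸ h.1⟩⟩
      -- If f = 0 the tail lies in the ideal. It contains all x_t^{d_t} with t ≠ v, so only
      -- x_v^{d_v} has to be added.
      by_cases hf : f = 0
      · subst hf
        have hins : insert v (V.erase v) = V := Finset.insert_erase h1
        have hnot : v ∉ V.erase v := Finset.notMem_erase v V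
        refine ⟨S.addColumn v (d v), ?_, ?_, ?_, ?_, Or.inl ?_⟩
        · simpa only [hins] using hS.addColumn (e := d v) hnot
        · intro u
          have := mem_addColumn_iff (u := u) (e := d v) hS hnot
          rw [hins] at this
          rw [this]
          simp only [Mem, Nat.zero_le, true_and]
          constructor
          · rintro (h | h)
            · exact Or.inl ⟨v, h1, h⟩
            · exact Or.inr h
          · rintro (⟨t, ht, h⟩ | h)
            · by_cases htv : t = v
              · exact Or.inl (htv ▸ h)
              · have ht' := Finset.mem_erase.2 ⟨htv, ht⟩
                exact Or.inr (mem_of_d_le ht' ((hSle t ht').trans h))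
            · exact Or.inr h
        · intro t ht
          rw [addColumn_d]
          by_cases htv : t = v
          · subst htv
            simp [TableChain.d]
          · rw [Function.update_of_ne htv]
            exact hSle t (Finset.mem_erase.2 ⟨htv, ht⟩)
        · rw [addColumn_d, addColumn_lead hS hnot, hsplit, hsplit, Function.update_self,
            Finset.sum_congr rfl fun t ht =>
              Function.update_of_ne (Finset.ne_of_mem_erase ht) _ _]
          simp only [d_cons, lead_cons]
          omega
        · simpa only [hins] using
            Reduced.addColumn hS hnot (Nat.pos_of_ne_zero (Ne.symm hfd)) hred
      · refine ⟨cons d v f S, ⟨h1, h2, hSle, hSsum, hS⟩, fun _ => Iff.rfl, fun _ _ => le_rfl,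
          rfl, Or.inl ⟨Nat.pos_of_ne_zero hf, lt_of_le_of_ne h2 hfd, hred⟩⟩
    -- The tail is the unit ideal, so x_v^f itself is a generator and replaces x_v^{d_v}.
    · refine ⟨base (Function.update d v f), ⟨v, h1⟩, ?_, ?_, ?_, hbase V _⟩
      · intro u
        have htop : (base e).Mem (V.erase v) u := ⟨t, ht, by omega⟩
        have hcons : (cons d v f (base e)).Mem V u ↔ (∃ t ∈ V, d t ≤ u t) ∨ f ≤ u v :=
          or_congr_right (and_iff_left htop)
        rw [hcons]
        constructor
        · rintro ⟨r, hr, h⟩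
          by_cases hrv : r = v
          · subst hrv
            exact Or.inr (by simpa using h)
          · exact Or.inl ⟨r, hr, by simpa [hrv] using h⟩
        · rintro (⟨r, hr, h⟩ | h)
          · by_cases hrv : r = v
            · subst hrv
              exact ⟨r, hr, by simpa using h2.trans h⟩
            · exact ⟨r, hr, by simpa [hrv] using h⟩
          · exact ⟨v, h1, by simpa using h⟩
      · intro t _
        by_cases htv : t = v
        · subst htv
          simpa [TableChain.d] using h2
        · simp [TableChain.d, htv]
      · simp only [d_base, lead_base, d_cons, lead_cons, hsplit, Function.update_self,
          (Finset.sum_congr rfl hupd :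
            ∑ t ∈ V.erase v, Function.update d v f t = ∑ t ∈ V.erase v, d t)] at *
        omega

/-! ### Deleting zero columns -/

theorem Reduced.subset (hr : R.Reduced V) (hWV : W ⊆ V) : R.Reduced W := by
  induction R generalizing V W with
  | base d => exact fun t ht => hr t (hWV ht)
  | cons d v f R ih => exact ⟨hr.1, hr.2.1, ih hr.2.2 (Finset.erase_subset_erase v hWV)⟩

/-- A zero column contributes equally to both sums in each constraint, so the constraints survive
its removal. -/
theorem Valid.subset (hv : R.Valid V) (hr : R.Reduced V) (hWV : W ⊆ V)
    (hW : ∀ t ∈ V, t ∉ W → R.IsZeroColumn t) (hne : W.Nonempty) : R.Valid W := by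
  induction R generalizing V W with
  | base d => exact hne
  | cons d v f R ih =>
    obtain ⟨h1, h2, h3, h4, h5⟩ := hv
    have hvW : v ∈ W := by
      by_contra h
      exact (hW v h1 h).1 rfl
    have hsub := Finset.erase_subset_erase v hWV
    have hzero : ∀ t ∈ V.erase v, t ∉ W.erase v → R.d t = d t ∧ R.IsZeroColumn t := by
      intro t ht htW
      exact (hW t (Finset.mem_of_mem_erase ht) fun h =>
        htW (Finset.mem_erase.2 ⟨Finset.ne_of_mem_erase ht, h⟩)).2
    have hsum : d v + ∑ t ∈ W.erase v, R.d t = ∑ t ∈ W.erase v, d t + R.lead := by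
      have e1 := Finset.sum_sdiff (f := R.d) hsub
      have e2 := Finset.sum_sdiff (f := d) hsub
      have e3 : ∑ t ∈ V.erase v \ W.erase v, R.d t = ∑ t ∈ V.erase v \ W.erase v, d t :=
        Finset.sum_congr rfl fun t ht =>
          (hzero t (Finset.mem_sdiff.1 ht).1 (Finset.mem_sdiff.1 ht).2).1
      omega
    refine ⟨hvW, h2, fun t ht => h3 t (hsub ht), hsum,
      ih h5 hr.2.2 hsub (fun t ht htW => (hzero t ht htW).2) ?_⟩
    cases R with
    | base e =>
      -- Without remaining columns the constraint would read d_v = 0, contrary to 0 < f < d v.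
      by_contra hempty
      rw [Finset.not_nonempty_iff_eq_empty] at hempty
      rw [hempty] at hsum
      have := hr.1
      have := hr.2.1
      simp [lead] at hsum
      omega
    | cons e w g S =>
      refine ⟨w, ?_⟩
      by_contra h
      exact (hzero w h5.1 h).2.1 rfl

theorem mem_iff_of_subset (hv : R.Valid V) (hWV : W ⊆ V)
    (hW : ∀ t ∈ V, t ∉ W → R.IsZeroColumn t) :
    R.Mem V u ↔ R.Mem W u ∨ ∃ t ∈ V \ W, R.d t ≤ u t := by
  have key : ∀ d : σ → ℕ, (∃ t ∈ V, d t ≤ u t) ↔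
      (∃ t ∈ W, d t ≤ u t) ∨ ∃ t ∈ V \ W, d t ≤ u t := by
    intro d
    conv_lhs => rw [← Finset.union_sdiff_of_subset hWV]
    simp only [Finset.mem_union, or_and_right, exists_or]
  have prop : ∀ a b c d : Prop, (a ∨ b) ∨ c ∧ (d ∨ b) ↔ (a ∨ c ∧ d) ∨ b := by tauto
  induction R generalizing V W with
  | base d => exact key d
  | cons d v f R ih =>
    obtain ⟨h1, h2, h3, h4, h5⟩ := hv
    have hvW : v ∈ W := by
      by_contra h
      exact (hW v h1 h).1 rfl
    have hsub := Finset.erase_subset_erase v hWV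
    have hzero : ∀ t ∈ V.erase v, t ∉ W.erase v → R.d t = d t ∧ R.IsZeroColumn t := by
      intro t ht htW
      exact (hW t (Finset.mem_of_mem_erase ht) fun h =>
        htW (Finset.mem_erase.2 ⟨Finset.ne_of_mem_erase ht, h⟩)).2
    have hsd : V.erase v \ W.erase v = V \ W := by
      ext t
      simp only [Finset.mem_sdiff, Finset.mem_erase]
      constructor
      · tauto
      · rintro ⟨ht, htW⟩
        have : t ≠ v := fun e => htW (e ▸ hvW)
        tauto
    have := ih h5 hsub (fun t ht htW => (hzero t ht htW).2) (by
      intro d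
      conv_lhs => rw [← Finset.union_sdiff_of_subset hsub]
      simp only [Finset.mem_union, or_and_right, exists_or])
    rw [hsd] at this
    have e : (∃ t ∈ V \ W, R.d t ≤ u t) ↔ ∃ t ∈ V \ W, d t ≤ u t := by
      refine exists_congr fun t => and_congr_right fun ht => ?_
      rw [← hsd] at ht
      rw [(hzero t (Finset.mem_sdiff.1 ht).1 (Finset.mem_sdiff.1 ht).2).1]
    simp only [Mem, key, this, d_cons, e, prop]

/-! ### Uniqueness of reduced tables -/

theorem cons_mem_of_mem_tail {d : σ → ℕ} {v : σ} {f : ℕ} (hv : (cons d v f R).Valid V)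
    (h : R.Mem (V.erase v) u) : (cons d v f R).Mem V (Function.update u v f) :=
  Or.inr ⟨by simp, (mem_update_iff hv.2.2.2.2 (Finset.notMem_erase v V)).2 h⟩

theorem update_lt_d {d : σ → ℕ} {v : σ} {f : ℕ} (hv : (cons d v f R).Valid V) (hfd : f < d v)
    (h : ∀ t ∈ V.erase v, u t < R.d t) : ∀ t ∈ V, Function.update u v f t < d t := by
  intro t ht
  by_cases e : t = v
  · subst e
    simpa using hfd
  · have ht' := Finset.mem_erase.2 ⟨e, ht⟩
    simpa [e] using (h t ht').trans_le (hv.2.2.1 t ht')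

/-- The generator m_{1,t}. By `mixed_lt` it is mixed as soon as α_{1,t} ≠ 0. -/
theorem mixed_mem {d : σ → ℕ} {v : σ} {f : ℕ} (hv : (cons d v f R).Valid V)
    {t : σ} (ht : t ∈ V.erase v) :
    (cons d v f R).Mem V (Function.update (Pi.single t (R.d t)) v f) :=
  cons_mem_of_mem_tail hv (mem_of_d_le ht (by simp))

theorem mixed_lt {d : σ → ℕ} {v : σ} {f : ℕ} (hv : (cons d v f R).Valid V)
    (hr : (cons d v f R).Reduced V) {t : σ} (hlt : R.d t < d t) :
    ∀ r ∈ V, Function.update (Pi.single t (R.d t) : σ → ℕ) v f r < d r := by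
  intro r hrV
  by_cases e : r = v
  · subst e
    simpa using hr.2.1
  · by_cases ert : r = t
    · subst ert
      simpa [e] using hlt
    · simpa [e, ert] using Reduced.d_pos hv hr r hrV

theorem exists_mixed (hv : R.Valid V) (hr : R.Reduced V) (hc : R.IsCons) :
    ∃ u, R.Mem V u ∧ ∀ t ∈ V, u t < R.d t := by
  induction R generalizing V with
  | base d => exact hc.elim
  | cons d v f R ih =>
    by_cases h : ∃ t ∈ V.erase v, R.d t < d t
    · obtain ⟨t, ht, hlt⟩ := h
      exact ⟨_, mixed_mem hv ht, mixed_lt hv hr hlt⟩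
    · push Not at h
      -- Now the first row vanishes off the diagonal, so its constraint equates d v with the leading
      -- entry of the tail. A base tail would give d v = 0; hence the tail has a constrained column.
      cases R with
      | base e =>
        have h1 := hv.2.2.2.1
        have : ∑ t ∈ V.erase v, d t ≤ ∑ t ∈ V.erase v, (base e).d t := Finset.sum_le_sum h
        have := hr.2.1
        simp only [lead_base, d_base] at *
        omega
      | cons e w g S =>
        obtain ⟨u, hu, hlt⟩ := ih hv.2.2.2.2 hr.2.2 trivial
        exact ⟨_, cons_mem_of_mem_tail hv hu, update_lt_d hv hr.2.1 hlt⟩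

/-- For t = v any mixed monomial works, since f > 0. If α_{1,t} ≠ 0 take m_{1,t}; otherwise lift a
monomial from the tail by x_v^f. -/
theorem exists_mixed_of_not_isZeroColumn (hv : R.Valid V) (hr : R.Reduced V) (hc : R.IsCons)
    {t : σ} (ht : t ∈ V) (hz : ¬ R.IsZeroColumn t) :
    ∃ u, R.Mem V u ∧ (∀ t ∈ V, u t < R.d t) ∧ ¬ R.Mem V (Function.update u t 0) := by
  have hupd : ∀ (u : σ → ℕ) (d : σ → ℕ), (∀ r ∈ V, u r < d r) →
      ¬ ∃ r ∈ V, d r ≤ Function.update u t 0 r := by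
    rintro u d h ⟨r, hrV, hle⟩
    have := h r hrV
    by_cases e : r = t
    · subst e
      simp at hle
      omega
    · simp [e] at hle
      omega
  induction R generalizing V with
  | base d => exact hc.elim
  | cons d v f R ih =>
    by_cases htv : t = v
    · subst htv
      obtain ⟨u, hu, hlt⟩ := exists_mixed hv hr hc
      refine ⟨u, hu, hlt, ?_⟩
      rintro (h | ⟨h, -⟩)
      · exact hupd u d hlt h
      · have := hr.1
        simp at h
        omega
    have ht' : t ∈ V.erase v := Finset.mem_erase.2 ⟨htv, ht⟩
    by_cases hlt : R.d t < d t
    · refine ⟨_, mixed_mem hv ht', mixed_lt hv hr hlt, ?_⟩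
      rintro (h | ⟨-, h⟩)
      · exact hupd _ d (mixed_lt hv hr hlt) h
      · refine Reduced.not_mem_zero hv.2.2.2.2 hr.2.2 ?_ h
        intro r hrV
        have hrv := Finset.ne_of_mem_erase hrV
        by_cases e : r = t
        · simp [e]
        · simp [e, hrv]
    · have hz' : ¬ R.IsZeroColumn t := fun h =>
        hz ⟨htv, le_antisymm (hv.2.2.1 t ht') (not_lt.1 hlt), h⟩
      have hc' : R.IsCons := by
        cases R with
        | base e => exact hz' trivial
        | cons e w g S => trivial
      obtain ⟨u, hu, hult, hun⟩ := ih hv.2.2.2.2 hr.2.2 hc' ht' hz' (by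
        rintro u d h ⟨r, hrV, hle⟩
        have := h r hrV
        by_cases e : r = t
        · subst e
          simp at hle
          omega
        · simp [e] at hle
          omega)
      have hlt' := update_lt_d hv hr.2.1 hult
      refine ⟨_, cons_mem_of_mem_tail hv hu, hlt', ?_⟩
      rintro (h | ⟨-, h⟩)
      · exact hupd _ d hlt' h
      · rw [Function.update_comm (Ne.symm htv), mem_update_iff hv.2.2.2.2
          (Finset.notMem_erase v V)] at h
        exact hun h

/-- The pure powers in the ideal recover the top row: every other generator involves v and a further
variable. -/
theorem mem_single_iff (hv : R.Valid V) (hr : R.Reduced V) {t : σ} (ht : t ∈ V) (k : ℕ) :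
    R.Mem V (Pi.single t k) ↔ R.d t ≤ k := by
  have key : (∃ r ∈ V, R.d r ≤ (Pi.single t k : σ → ℕ) r) → R.d t ≤ k := by
    rintro ⟨r, hrV, h⟩
    by_cases e : r = t
    · subst e
      simpa using h
    · have := Reduced.d_pos hv hr r hrV
      simp [e] at h
      omega
  refine ⟨fun h => ?_, fun h => mem_of_d_le ht (by simpa using h)⟩
  cases R with
  | base d => exact key h
  | cons d v f R =>
    rcases h with h | ⟨h1, h2⟩
    · exact key h
    · have hvt : v = t := by
        by_contra e
        have := hr.1
        simp [e] at h1
        omega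
      subst hvt
      refine absurd h2 (Reduced.not_mem_zero hv.2.2.2.2 hr.2.2 fun r hrV => ?_)
      simp [Finset.ne_of_mem_erase hrV]

/-- If α_{1,t} ≠ 0 then m_{1,t} is mixed and involves only v and t, so c can be the only such t. The
constraint becomes d v = (d c - R.d c) + R.lead, and it remains to see that R.lead < R.d c. -/
theorem d_lt_of_common {d : σ → ℕ} {v c : σ} {f : ℕ} (hv : (cons d v f R).Valid V)
    (hr : (cons d v f R).Reduced V) (hcV : c ∈ V) (hcv : c ≠ v)
    (hc : ∀ u, (cons d v f R).Mem V u → (∀ t ∈ V, u t < d t) → 0 < u c) : d v < d c := by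
  have hcV' : c ∈ V.erase v := Finset.mem_erase.2 ⟨hcv, hcV⟩
  have heq : ∀ t ∈ (V.erase v).erase c, R.d t = d t := by
    intro t ht
    by_contra hne
    have ht' := Finset.mem_of_mem_erase ht
    have := hc _ (mixed_mem hv ht')
      (mixed_lt hv hr (lt_of_le_of_ne (hv.2.2.1 t ht') hne))
    simp [hcv, (Finset.ne_of_mem_erase ht).symm] at this
  have hsum := hv.2.2.2.1
  have hpos := Reduced.d_pos hv.2.2.2.2 hr.2.2 c hcV'
  rw [← Finset.add_sum_erase _ _ hcV', ← Finset.add_sum_erase _ d hcV',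
    (Finset.sum_congr rfl heq :
      ∑ t ∈ (V.erase v).erase c, R.d t = ∑ t ∈ (V.erase v).erase c, d t)] at hsum
  induction R generalizing V d v f with
  | base e =>
    simp only [lead_base] at hsum
    omega
  | cons e w g S ih =>
    simp only [lead_cons, d_cons] at hsum hpos
    -- If c heads the tail, its leading entry is e c - g with g > 0. Otherwise c is common to the
    -- mixed monomials of the tail, and induction gives e w < e c.
    by_cases hcw : c = w
    · subst hcw
      have := hr.2.2.1
      have := hr.2.2.2.1
      omega
    · have hc' : ∀ u, (cons e w g S).Mem (V.erase v) u → (∀ t ∈ V.erase v, u t < e t) →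
          0 < u c := by
        intro u hu hlt
        simpa [hcv] using hc _ (cons_mem_of_mem_tail hv hu) (update_lt_d hv hr.2.1 hlt)
      have hv' := hv.2.2.2.2
      have hcV'' : c ∈ (V.erase v).erase w := Finset.mem_erase.2 ⟨hcw, hcV'⟩
      have heq' : ∀ t ∈ ((V.erase v).erase w).erase c, S.d t = e t := by
        intro t ht
        by_contra hne
        have ht' := Finset.mem_of_mem_erase ht
        have := hc' _ (mixed_mem hv' ht')
          (mixed_lt hv' hr.2.2 (lt_of_le_of_ne (hv'.2.2.1 t ht') hne))
        simp [hcw, (Finset.ne_of_mem_erase ht).symm] at this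
      have hsum' := hv'.2.2.2.1
      rw [← Finset.add_sum_erase _ _ hcV'', ← Finset.add_sum_erase _ e hcV'',
        (Finset.sum_congr rfl heq' : ∑ t ∈ ((V.erase v).erase w).erase c, S.d t =
          ∑ t ∈ ((V.erase v).erase w).erase c, e t)] at hsum'
      have := ih hv' hr.2.2 hcV' hcw hc' hcV'' heq' hsum'
        (Reduced.d_pos hv'.2.2.2.2 hr.2.2.2.2 c hcV'')
      omega

/-- As f < d v, the power x_v^{d_v} plays no role at exponent f, and the other x_t^{d_t} already lie
in the tail. -/
theorem mem_update_iff_mem_tail {d : σ → ℕ} {v : σ} {f : ℕ} (hv : (cons d v f R).Valid V)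
    (hr : (cons d v f R).Reduced V) :
    (cons d v f R).Mem V (Function.update u v f) ↔ R.Mem (V.erase v) u := by
  refine ⟨?_, cons_mem_of_mem_tail hv⟩
  rintro (⟨t, ht, h⟩ | ⟨-, h⟩)
  · by_cases e : t = v
    · subst e
      have := hr.2.1
      simp at h
      omega
    · have ht' := Finset.mem_erase.2 ⟨e, ht⟩
      exact mem_of_d_le ht' ((hv.2.2.1 t ht').trans (by simpa [e] using h))
  · exact (mem_update_iff hv.2.2.2.2 (Finset.notMem_erase v V)).1 h

theorem not_base_and_cons {d d' : σ → ℕ} {v : σ} {f : ℕ} (hd : ∀ t ∈ V, d t = d' t)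
    (hv : (cons d' v f R).Valid V) (hr : (cons d' v f R).Reduced V)
    (h : ∀ u, (base d).Mem V u ↔ (cons d' v f R).Mem V u) : False := by
  obtain ⟨u, hu, hlt⟩ := exists_mixed hv hr trivial
  obtain ⟨t, ht, hle⟩ := (h u).2 hu
  have := hlt t ht
  simp only [d_cons, ← hd t ht] at this
  omega

theorem le_of_mem_of_lt {d : σ → ℕ} {v : σ} {f : ℕ} (h : (cons d v f R).Mem V u)
    (hlt : ∀ t ∈ V, u t < d t) : f ≤ u v := by
  rcases h with ⟨t, ht, h⟩ | ⟨h, -⟩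
  · exact absurd (hlt t ht) (not_lt.2 h)
  · exact h

/-- A reduced table is determined by its ideal. -/
theorem eqv_of_mem_iff (hv : R.Valid V) (hr : R.Reduced V) (hv' : R'.Valid V)
    (hr' : R'.Reduced V) (h : ∀ u, R.Mem V u ↔ R'.Mem V u) : R.Eqv V R' := by
  have hd : ∀ {V : Finset σ} {R R' : TableChain σ}, R.Valid V → R.Reduced V → R'.Valid V →
      R'.Reduced V → (∀ u, R.Mem V u ↔ R'.Mem V u) → ∀ t ∈ V, R.d t = R'.d t :=
    fun hv hr hv' hr' h t ht => eq_of_forall_ge_iff fun k => by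
      rw [← mem_single_iff hv hr ht, ← mem_single_iff hv' hr' ht, h]
  have hdV := hd hv hr hv' hr' h
  -- Lowering the exponent of v in a mixed monomial to f keeps it mixed, so f is attained and bounds
  -- f' from above.
  have hf : ∀ {V : Finset σ} {d d' : σ → ℕ} {v : σ} {f f' : ℕ} {R R' : TableChain σ},
      (∀ t ∈ V, d t = d' t) → (cons d v f R).Valid V → (cons d v f R).Reduced V →
      (∀ u, (cons d v f R).Mem V u → (cons d' v f' R').Mem V u) → f' ≤ f := by
    intro V d d' v f f' R R' hd hv hr h
    obtain ⟨u, hu, hlt⟩ := exists_mixed hv hr trivial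
    have hu' : (cons d v f R).Mem V (Function.update u v f) := by
      rcases hu with ⟨t, ht, hu⟩ | ⟨-, hu⟩
      · exact absurd (hlt t ht) (not_lt.2 hu)
      · exact cons_mem_of_mem_tail hv hu
    have := le_of_mem_of_lt (h _ hu') fun t ht => by
      rw [← hd t ht]
      by_cases e : t = v
      · subst e
        simpa using hr.2.1
      · simpa [e] using hlt t ht
    simpa using this
  induction R generalizing V R' with
  | base d =>
    cases R' with
    | base d' => exact hdV
    | cons d' v' f' R' => exact not_base_and_cons hdV hv' hr' h
  | cons d v f R ih =>
    cases R' with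
    | base d' => exact not_base_and_cons (fun t ht => (hdV t ht).symm) hv hr fun u => (h u).symm
    | cons d' v' f' R' =>
      simp only [d_cons] at hdV
      have hvv : v = v' := by
        by_contra hne
        have h1 : d v < d v' := d_lt_of_common hv hr hv'.1 (Ne.symm hne) fun u hu hlt =>
          hr'.1.trans_le (le_of_mem_of_lt ((h u).1 hu) fun t ht => hdV t ht ▸ hlt t ht)
        have h2 : d' v' < d' v := d_lt_of_common hv' hr' hv.1 hne fun u hu hlt =>
          hr.1.trans_le (le_of_mem_of_lt ((h u).2 hu) fun t ht => (hdV t ht).symm ▸ hlt t ht)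
        rw [hdV v hv.1, hdV v' hv'.1] at h1
        omega
      subst hvv
      have hff : f = f' := le_antisymm (hf (fun t ht => (hdV t ht).symm) hv' hr' fun u => (h u).2)
        (hf hdV hv hr fun u => (h u).1)
      subst hff
      have htail : ∀ u, R.Mem (V.erase v) u ↔ R'.Mem (V.erase v) u := fun u => by
        rw [← mem_update_iff_mem_tail hv hr, ← mem_update_iff_mem_tail hv' hr', h]
      exact ⟨hdV, rfl, rfl, ih hv.2.2.2.2 hr.2.2 hv'.2.2.2.2 hr'.2.2 htail
        (hd hv.2.2.2.2 hr.2.2 hv'.2.2.2.2 hr'.2.2 htail)⟩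

/-! ### Congruence -/

theorem Eqv.d_eq (h : R.Eqv V R') : ∀ t ∈ V, R.d t = R'.d t := by
  cases R <;> cases R' <;> first | exact h.elim | exact h.1 | exact h

theorem Eqv.mem_iff (hv : R.Valid V) (h : R.Eqv V R') : R.Mem V u ↔ R'.Mem V u := by
  have key : ∀ {V : Finset σ} {d d' : σ → ℕ}, (∀ t ∈ V, d t = d' t) →
      ((∃ t ∈ V, d t ≤ u t) ↔ ∃ t ∈ V, d' t ≤ u t) := fun h =>
    exists_congr fun t => and_congr_right fun ht => by rw [h t ht]
  induction R generalizing V R' with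
  | base d =>
    cases R' with
    | base d' => exact key h
    | cons => exact h.elim
  | cons d v f R ih =>
    cases R' with
    | base d' => exact h.elim
    | cons d' v' f' R' =>
      obtain ⟨h1, rfl, rfl, h2⟩ := h
      exact or_congr (key h1) (and_congr_right fun _ => ih hv.2.2.2.2 h2)

theorem Eqv.reduced (hv : R.Valid V) (h : R.Eqv V R') (hr : R'.Reduced V) : R.Reduced V := by
  induction R generalizing V R' with
  | base d =>
    cases R' with
    | base d' => exact fun t ht => (h t ht).symm ▸ hr t ht
    | cons => exact h.elim
  | cons d v f R ih =>
    cases R' with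
    | base d' => exact h.elim
    | cons d' v' f' R' =>
      obtain ⟨h1, rfl, rfl, h2⟩ := h
      exact ⟨hr.1, h1 v hv.1 ▸ hr.2.1, ih hv.2.2.2.2 h2 hr.2.2⟩

theorem Eqv.isZeroColumn (h : R.Eqv V R') {t : σ} (ht : t ∈ V) (hz : R.IsZeroColumn t) :
    R'.IsZeroColumn t := by
  induction R generalizing V R' with
  | base d =>
    cases R' with
    | base d' => trivial
    | cons => exact h.elim
  | cons d v f R ih =>
    cases R' with
    | base d' => exact h.elim
    | cons d' v' f' R' =>
      obtain ⟨h1, rfl, rfl, h2⟩ := h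
      have ht' := Finset.mem_erase.2 ⟨hz.1, ht⟩
      exact ⟨hz.1, by rw [← h2.d_eq t ht', hz.2.1, h1 t ht], ih h2 ht' hz.2.2⟩

end TableChain

/-! ### Passage between tables and their recursive form -/

namespace Table

variable {s n : ℕ} {σ : Type*}

@[ext]
theorem ext {T T' : Table s n} (hd : T.d = T'.d) (hα : T.α = T'.α) : T = T' := by
  cases T
  cases T'
  simp only at hd hα
  subst hd hα
  rfl

theorem α_le_d (T : Table s n) (i : Fin s) (j : Fin n) : T.α i j ≤ T.d j :=
  (Finset.single_le_sum (f := fun i => T.α i j) (fun _ _ => Nat.zero_le _)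
    (Finset.mem_univ i)).trans (T.col_le j)

theorem α_succ_zero (T : Table (s + 1) (n + 1)) (i : Fin s) : T.α i.succ 0 = 0 :=
  T.lower_zero _ _ (by simp)

/-- The table obtained by deleting the first row and the first column. -/
def tail (T : Table (s + 1) (n + 1)) : Table s n where
  lt := Nat.lt_of_succ_lt_succ T.lt
  d j := T.d j.succ - T.α 0 j.succ
  α i j := T.α i.succ j.succ
  lower_zero i j h := T.lower_zero _ _ (by simpa using h)
  col_le j := by
    have := T.col_le j.succ
    rw [Fin.sum_univ_succ] at this
    omega
  constraint k := by
    have h := T.constraint k.succ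
    have hc : Fin.castLE T.lt.le k.succ =
      (Fin.castLE (Nat.lt_of_succ_lt_succ T.lt).le k).succ := rfl
    have hα := T.α_le_d 0 (Fin.castLE (Nat.lt_of_succ_lt_succ T.lt).le k).succ
    have e : (if h : (k.succ : ℕ) + 1 < s + 1 then
        T.α ⟨k.succ + 1, h⟩ ⟨k.succ + 1, h.trans T.lt⟩ else 0) =
        if h : (k : ℕ) + 1 < s then T.α (Fin.succ ⟨k + 1, h⟩)
          (Fin.succ ⟨k + 1, h.trans (Nat.lt_of_succ_lt_succ T.lt)⟩) else 0 := by
      by_cases hk : (k : ℕ) + 1 < s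
      · rw [dif_pos hk, dif_pos (by simpa using hk)]
        rfl
      · rw [dif_neg hk, dif_neg (by simpa using hk)]
    rw [hc, e, Finset.sum_filter, Finset.sum_filter] at h
    rw [Finset.sum_filter, Finset.sum_filter]
    simp only [Fin.sum_univ_succ, Fin.succ_pos, if_true, Fin.val_succ,
      Fin.val_zero, Nat.not_lt_zero, if_false, zero_add, Fin.succ_lt_succ_iff,
      add_lt_add_iff_right] at h ⊢
    omega

/-- The first diagonal entry, `0` if there is none. -/
def lead (T : Table s n) : ℕ :=
  if h : 0 < s then T.α ⟨0, h⟩ ⟨0, h.trans T.lt⟩ else 0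

/-- The table with first row and column added to a given one. -/
def cons (T : Table s n) (d : Fin (n + 1) → ℕ) (a : ℕ) (ha : a ≤ d 0)
    (hle : ∀ j : Fin n, T.d j ≤ d j.succ)
    (hsum : d 0 + ∑ j, T.d j = ∑ j : Fin n, d j.succ + T.lead) : Table (s + 1) (n + 1) where
  lt := Nat.succ_lt_succ T.lt
  d := d
  α := Fin.cons (Fin.cons a fun j => d j.succ - T.d j) fun i => Fin.cons 0 (T.α i)
  lower_zero i j h := by
    cases i using Fin.cases with
    | zero => simp at h
    | succ i =>
      cases j using Fin.cases with
      | zero => simp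
      | succ j => simpa using T.lower_zero i j (by simpa using h)
  col_le j := by
    rw [Fin.sum_univ_succ]
    cases j using Fin.cases with
    | zero => simpa using ha
    | succ j =>
      have := T.col_le j
      have := hle j
      simp only [Fin.cons_zero, Fin.cons_succ]
      omega
  constraint k := by
    cases k using Fin.cases with
    | zero =>
      have hc : Fin.castLE (Nat.succ_lt_succ T.lt).le (0 : Fin (s + 1)) = 0 := rfl
      have e : ∑ j : Fin n, (d j.succ - T.d j) + ∑ j, T.d j = ∑ j : Fin n, d j.succ := by
        rw [← Finset.sum_add_distrib]
        exact Finset.sum_congr rfl fun j _ => Nat.sub_add_cancel (hle j)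
      have e' : (if h : 0 + 1 < s + 1 then
          (Fin.cons (Fin.cons a fun j => d j.succ - T.d j) fun i => Fin.cons 0 (T.α i) :
            Fin (s + 1) → Fin (n + 1) → ℕ) ⟨0 + 1, h⟩ ⟨0 + 1, h.trans (Nat.succ_lt_succ T.lt)⟩
          else 0) = T.lead := by
        unfold lead
        by_cases hs : 0 < s
        · rw [dif_pos hs, dif_pos (by omega)]
          rfl
        · rw [dif_neg hs, dif_neg (by omega)]
      rw [hc, Finset.sum_filter, Finset.sum_filter]
      erw [e']
      simp only [Fin.sum_univ_succ, Fin.val_zero, Fin.val_succ,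
        Fin.cons_zero, Fin.cons_succ, Fin.not_lt_zero, if_false, lt_self_iff_false,
        Nat.succ_pos, if_true, Finset.sum_const_zero]
      omega
    | succ k =>
      have h := T.constraint k
      have hc : Fin.castLE (Nat.succ_lt_succ T.lt).le k.succ = (Fin.castLE T.lt.le k).succ := rfl
      have hd := hle (Fin.castLE T.lt.le k)
      have e : (if h : (k.succ : ℕ) + 1 < s + 1 then
          (Fin.cons (Fin.cons a fun j => d j.succ - T.d j) fun i => Fin.cons 0 (T.α i) :
            Fin (s + 1) → Fin (n + 1) → ℕ) ⟨k.succ + 1, h⟩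
              ⟨k.succ + 1, h.trans (Nat.succ_lt_succ T.lt)⟩
          else 0) = if h : (k : ℕ) + 1 < s then T.α ⟨k + 1, h⟩ ⟨k + 1, h.trans T.lt⟩ else 0 := by
        by_cases hs : (k : ℕ) + 1 < s
        · rw [dif_pos hs, dif_pos (by simpa using hs)]
          rfl
        · rw [dif_neg hs, dif_neg (by simpa using hs)]
      rw [e, hc, Finset.sum_filter, Finset.sum_filter]
      rw [Finset.sum_filter, Finset.sum_filter] at h
      simp only [Fin.sum_univ_succ, Fin.val_zero, Fin.val_succ,
        Fin.cons_zero, Fin.cons_succ, Nat.not_lt_zero, if_false, Fin.succ_pos, if_true,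
        Fin.succ_lt_succ_iff, add_lt_add_iff_right] at h ⊢
      omega

theorem tail_cons (T : Table s n) (d : Fin (n + 1) → ℕ) (a : ℕ) (ha : a ≤ d 0)
    (hle : ∀ j : Fin n, T.d j ≤ d j.succ)
    (hsum : d 0 + ∑ j, T.d j = ∑ j : Fin n, d j.succ + T.lead) :
    (T.cons d a ha hle hsum).tail = T := by
  apply ext
  · funext j
    have := hle j
    simp only [tail, cons, Fin.cons_zero, Fin.cons_succ]
    omega
  · rfl

theorem constraint_zero (T : Table (s + 1) (n + 1)) :
    T.d 0 + ∑ j, T.tail.d j = ∑ j : Fin n, T.d j.succ + T.tail.lead := by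
  have h := T.constraint 0
  have hc : Fin.castLE T.lt.le (0 : Fin (s + 1)) = 0 := rfl
  have e : ∑ j : Fin n, T.α 0 j.succ + ∑ j, T.tail.d j = ∑ j : Fin n, T.d j.succ := by
    rw [← Finset.sum_add_distrib]
    exact Finset.sum_congr rfl fun j _ => Nat.add_sub_cancel' (T.α_le_d 0 j.succ)
  have e' : (if h : ((0 : Fin (s + 1)) : ℕ) + 1 < s + 1 then
      T.α ⟨(0 : Fin (s + 1)) + 1, h⟩ ⟨(0 : Fin (s + 1)) + 1, h.trans T.lt⟩ else 0)
        = T.tail.lead := by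
    unfold lead
    by_cases hs : 0 < s
    · rw [dif_pos hs, dif_pos (by simpa using hs)]
      rfl
    · rw [dif_neg hs, dif_neg (by simpa using hs)]
  rw [e', hc, Finset.sum_filter, Finset.sum_filter] at h
  simp only [Fin.sum_univ_succ, Fin.val_zero, Fin.val_succ,
    Fin.not_lt_zero, if_false, lt_self_iff_false,
    Nat.succ_pos, if_true, Finset.sum_const_zero] at h
  omega

/-- The recursive form of a table with labels. -/
noncomputable def toChain : ∀ {s n : ℕ}, Table s n → (Fin n ↪ σ) → TableChain σ
  -- The value 0 off the labels is arbitrary; hence recursive forms are compared by `Eqv` on V only.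
  | 0, _, T, var => .base (Function.extend var T.d 0)
  | _ + 1, 0, T, _ => absurd T.lt (Nat.not_lt_zero _)
  | _ + 1, n + 1, T, var =>
      .cons (Function.extend var T.d 0) (var 0) (T.d 0 - T.α 0 0)
        (T.tail.toChain ((Fin.succEmb n).trans var))

/-- The exponents of the monomials in the ideal of a table. -/
def Mem (T : Table s n) (u : Fin n → ℕ) : Prop :=
  ∃ (i : Fin (s + 1)) (j : Fin n), (i : ℕ) ≤ j ∧
    ∀ t : Fin n, ((t : ℕ) < i ∨ t = j) → T.expo i t ≤ u t

/-- Normal form, except that zero columns are allowed. -/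
def Reduced (T : Table s n) : Prop :=
  (∀ i : Fin s, T.α i (Fin.castLE T.lt.le i) ≠ 0) ∧ ∀ j : Fin n, ∑ i, T.α i j < T.d j

theorem expo_zero (T : Table s n) (t : Fin n) : T.expo 0 t = T.d t := by
  simp [expo]

theorem expo_succ_zero (T : Table (s + 1) (n + 1)) (i : Fin (s + 1)) :
    T.expo i.succ 0 = T.d 0 - T.α 0 0 := by
  simp [expo, Finset.sum_filter, Fin.sum_univ_succ, T.α_succ_zero]

theorem expo_succ_succ (T : Table (s + 1) (n + 1)) (i : Fin (s + 1)) (t : Fin n) :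
    T.expo i.succ t.succ = T.tail.expo i t := by
  simp only [expo, Finset.sum_filter, Fin.sum_univ_succ, tail, Nat.sub_sub, Fin.val_succ,
    Fin.val_zero, Nat.succ_pos, if_true, add_lt_add_iff_right]

theorem mem_succ_iff (T : Table (s + 1) (n + 1)) (u : Fin (n + 1) → ℕ) :
    T.Mem u ↔ (∃ j, T.d j ≤ u j) ∨ (T.d 0 - T.α 0 0 ≤ u 0 ∧ T.tail.Mem fun j => u j.succ) := by
  constructor
  · rintro ⟨i, j, hij, h⟩
    cases i using Fin.cases with
    | zero => exact Or.inl ⟨j, T.expo_zero j ▸ h j (Or.inr rfl)⟩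
    | succ i =>
      cases j using Fin.cases with
      | zero => simp at hij
      | succ j =>
        refine Or.inr ⟨T.expo_succ_zero i ▸ h 0 (Or.inl (by simp)), i, j, by simpa using hij,
          fun t ht => ?_⟩
        rw [← T.expo_succ_succ]
        exact h _ (by simpa using ht)
  · rintro (⟨j, h⟩ | ⟨h0, i, j, hij, h⟩)
    · refine ⟨0, j, by simp, fun t ht => ?_⟩
      obtain rfl : t = j := by simpa using ht
      rwa [T.expo_zero]
    · refine ⟨i.succ, j.succ, by simpa using hij, fun t ht => ?_⟩
      cases t using Fin.cases with
      | zero => rwa [T.expo_succ_zero]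
      | succ t =>
        rw [T.expo_succ_succ]
        exact h t (by simpa using ht)

theorem reduced_succ_iff (T : Table (s + 1) (n + 1)) :
    T.Reduced ↔ 0 < T.d 0 - T.α 0 0 ∧ T.d 0 - T.α 0 0 < T.d 0 ∧ T.tail.Reduced := by
  have hlt := T.lt
  have h0 : Fin.castLE T.lt.le (0 : Fin (s + 1)) = 0 := rfl
  have h1 : ∀ i : Fin s, Fin.castLE T.lt.le i.succ = (Fin.castLE T.tail.lt.le i).succ :=
    fun _ => rfl
  have h2 : ∀ j : Fin n, T.α 0 j.succ + ∑ i : Fin s, T.α i.succ j.succ < T.d j.succ ↔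
      ∑ i : Fin s, T.α i.succ j.succ < T.d j.succ - T.α 0 j.succ := fun j => by omega
  simp only [Reduced, Fin.forall_fin_succ, h0, h1, Fin.sum_univ_succ, T.α_succ_zero, h2,
    Finset.sum_const_zero, add_zero]
  have := T.α_le_d 0 0
  constructor
  · rintro ⟨⟨h3, h4⟩, h5, h6⟩
    exact ⟨by omega, by omega, h4, h6⟩
  · rintro ⟨h3, h4, h5, h6⟩
    exact ⟨⟨by omega, h5⟩, by omega, h6⟩

theorem toChain_d (T : Table s n) (var : Fin n ↪ σ) (j : Fin n) :
    (T.toChain var).d (var j) = T.d j := by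
  cases s with
  | zero => exact var.injective.extend_apply _ _ _
  | succ s =>
    cases n with
    | zero => exact j.elim0
    | succ n => exact var.injective.extend_apply _ _ _

theorem toChain_lead (T : Table s n) (var : Fin n ↪ σ) : (T.toChain var).lead = T.lead := by
  cases s with
  | zero => rfl
  | succ s =>
    cases n with
    | zero => exact absurd T.lt (Nat.not_lt_zero _)
    | succ n =>
      have := T.α_le_d 0 0
      have e : T.lead = T.α 0 0 := rfl
      simp only [toChain, TableChain.lead_cons, var.injective.extend_apply, e]
      omega

theorem isCons_toChain (T : Table s n) (var : Fin n ↪ σ) : (T.toChain var).IsCons ↔ 1 ≤ s := by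
  cases s with
  | zero => simp [toChain, TableChain.IsCons]
  | succ s =>
    cases n with
    | zero => exact absurd T.lt (Nat.not_lt_zero _)
    | succ n => simp [toChain, TableChain.IsCons]

theorem isZeroColumn_toChain_iff (T : Table s n) (var : Fin n ↪ σ) (j : Fin n) :
    (T.toChain var).IsZeroColumn (var j) ↔ s ≤ (j : ℕ) ∧ ∀ i, T.α i j = 0 := by
  induction s generalizing n with
  | zero => simp [toChain, TableChain.IsZeroColumn]
  | succ s ih =>
    cases n with
    | zero => exact j.elim0
    | succ n =>
      simp only [toChain, TableChain.IsZeroColumn, var.injective.extend_apply,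
        var.injective.ne_iff]
      cases j using Fin.cases with
      | zero => simp
      | succ j =>
        have h1 := ih T.tail ((Fin.succEmb n).trans var) j
        have h2 := T.tail.toChain_d ((Fin.succEmb n).trans var) j
        have h3 := T.α_le_d 0 j.succ
        simp only [Function.Embedding.trans_apply, Fin.coe_succEmb, tail] at h1 h2
        simp only [tail, h1, h2, Fin.forall_fin_succ (P := fun i => T.α i j.succ = 0),
          Fin.val_succ, add_le_add_iff_right, ne_eq, Fin.succ_ne_zero, not_false_eq_true, true_and]
        have : T.d j.succ - T.α 0 j.succ = T.d j.succ ↔ T.α 0 j.succ = 0 := by omega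
        rw [this]
        tauto

section

variable [DecidableEq σ]

theorem map_univ_erase (var : Fin (n + 1) ↪ σ) :
    (Finset.univ.map var).erase (var 0) = Finset.univ.map ((Fin.succEmb n).trans var) := by
  rw [← Finset.map_erase, ← Finset.map_map]
  congr 1
  ext t
  cases t using Fin.cases <;> simp

theorem toChain_mem_iff (T : Table s n) (var : Fin n ↪ σ) (u : σ → ℕ) :
    (T.toChain var).Mem (Finset.univ.map var) u ↔ T.Mem fun j => u (var j) := by
  induction s generalizing n with
  | zero =>
    simp only [toChain, TableChain.Mem, Finset.mem_map, Finset.mem_univ, true_and,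
      exists_exists_eq_and, var.injective.extend_apply]
    constructor
    · rintro ⟨j, h⟩
      refine ⟨0, j, by simp, fun t ht => ?_⟩
      obtain rfl : t = j := by simpa using ht
      rwa [T.expo_zero]
    · rintro ⟨i, j, -, h⟩
      have := h j (Or.inr rfl)
      rw [show i = 0 from Fin.ext (by omega), T.expo_zero] at this
      exact ⟨j, this⟩
  | succ s ih =>
    cases n with
    | zero => exact absurd T.lt (Nat.not_lt_zero _)
    | succ n =>
      simp only [toChain, TableChain.Mem, Finset.mem_map, Finset.mem_univ, true_and,
        exists_exists_eq_and, var.injective.extend_apply, map_univ_erase, ih, mem_succ_iff]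
      rfl

theorem toChain_valid (T : Table s n) (var : Fin n ↪ σ) :
    (T.toChain var).Valid (Finset.univ.map var) := by
  induction s generalizing n with
  | zero =>
    have : Nonempty (Fin n) := ⟨⟨0, T.lt⟩⟩
    simp [toChain, TableChain.Valid, Finset.univ_nonempty]
  | succ s ih =>
    cases n with
    | zero => exact absurd T.lt (Nat.not_lt_zero _)
    | succ n =>
      have h1 := fun j => T.tail.toChain_d ((Fin.succEmb n).trans var) j
      simp only [toChain, TableChain.Valid, map_univ_erase, toChain_lead, Finset.sum_map, h1]
      refine ⟨by simp, by simp [var.injective.extend_apply], ?_, ?_, ih _ _⟩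
      · intro t ht
        obtain ⟨j, -, rfl⟩ := Finset.mem_map.1 ht
        rw [h1]
        simp [var.injective.extend_apply, tail]
      · simpa [var.injective.extend_apply] using T.constraint_zero

theorem toChain_reduced_iff (T : Table s n) (var : Fin n ↪ σ) :
    (T.toChain var).Reduced (Finset.univ.map var) ↔ T.Reduced := by
  induction s generalizing n with
  | zero => simp [toChain, TableChain.Reduced, Reduced, var.injective.extend_apply]
  | succ s ih =>
    cases n with
    | zero => exact absurd T.lt (Nat.not_lt_zero _)
    | succ n =>
      simp only [toChain, TableChain.Reduced, map_univ_erase, ih, reduced_succ_iff,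
        var.injective.extend_apply]

theorem exists_toChain_eqv {V : Finset σ} {R : TableChain σ} (hv : R.Valid V) :
    ∃ (s n : ℕ) (T : Table s n) (var : Fin n ↪ σ),
      Finset.univ.map var = V ∧ (T.toChain var).Eqv V R := by
  induction R generalizing V with
  | base d =>
    let var : Fin V.card ↪ σ := V.equivFin.symm.toEmbedding.trans (Function.Embedding.subtype _)
    refine ⟨0, V.card, ⟨Finset.card_pos.2 hv, fun j => d (var j), fun i => i.elim0,
      fun i => i.elim0, by simp, fun i => i.elim0⟩, var, ?_, ?_⟩
    · rw [← Finset.map_map, Finset.map_univ_equiv]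
      exact Finset.attach_map_val
    · intro t ht
      obtain ⟨j, hj⟩ := V.equivFin.symm.surjective ⟨t, ht⟩
      obtain rfl : var j = t := congrArg Subtype.val hj
      exact var.injective.extend_apply _ _ _
  | cons d v f R ih =>
    obtain ⟨h1, h2, h3, h4, h5⟩ := hv
    obtain ⟨s, n, T, var, hvar, hT⟩ := ih h5
    have hmem : ∀ j, var j ∈ V.erase v := fun j => hvar ▸ Finset.mem_map_of_mem _ (by simp)
    have hTd : ∀ j, T.d j = R.d (var j) := fun j => by
      rw [← hT.d_eq _ (hmem j), toChain_d]
    obtain ⟨var', h0, hs⟩ : ∃ var' : Fin (n + 1) ↪ σ, var' 0 = v ∧ ∀ j, var' j.succ = var j :=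
      ⟨⟨Fin.cons v var, Fin.cons_injective_iff.2
        ⟨fun ⟨j, hj⟩ => Finset.ne_of_mem_erase (hmem j) hj, var.injective⟩⟩, rfl, fun _ => rfl⟩
    subst h0
    have hV : Finset.univ.map var' = V := by
      rw [← Finset.insert_erase h1, ← hvar]
      ext t
      simp [Fin.exists_fin_succ, eq_comm, hs]
    have hs' : (Fin.succEmb n).trans var' = var := Function.Embedding.ext hs
    have hlead : T.lead = R.lead := by
      rw [← toChain_lead T var]
      revert hT
      cases T.toChain var <;> cases R <;> intro hT
      · rfl
      · exact hT.elim
      · exact hT.elim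
      · obtain ⟨e1, rfl, rfl, -⟩ := hT
        simp only [TableChain.lead_cons, e1 _ h5.1]
    refine ⟨s + 1, n + 1, T.cons (fun j => d (var' j)) (d (var' 0) - f) (Nat.sub_le _ _) ?_ ?_,
      var', hV, ?_, rfl, Nat.sub_sub_self h2, ?_⟩
    · intro j
      rw [hTd, hs]
      exact h3 _ (hmem j)
    · rw [← hvar, Finset.sum_map, Finset.sum_map] at h4
      simpa only [hTd, hlead, hs] using h4
    · intro t ht
      obtain ⟨j, -, rfl⟩ := Finset.mem_map.1 (hV.symm ▸ ht)
      exact var'.injective.extend_apply _ _ _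
    · rw [tail_cons, hs']
      exact hT

/-- The recursive form remembers the order of the constrained columns but only the labels of the
others, which is exactly the freedom in `LabelledTable.Same`. -/
theorem eq_of_toChain_eqv {s' n' : ℕ} {T : Table s n} {T' : Table s' n'} {var : Fin n ↪ σ}
    {var' : Fin n' ↪ σ} (hV : Finset.univ.map var = Finset.univ.map var')
    (h : (T.toChain var).Eqv (Finset.univ.map var) (T'.toChain var')) :
    s = s' ∧ ∀ (j : Fin n) (j' : Fin n'), var j = var' j' → T.d j = T'.d j' ∧
      ((j : ℕ) < s → (j' : ℕ) = j) ∧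
      ∀ (i : Fin s) (i' : Fin s'), (i : ℕ) = i' → T.α i j = T'.α i' j' := by
  have hd : ∀ (j : Fin n) (j' : Fin n'), var j = var' j' → T.d j = T'.d j' := by
    intro j j' hj
    have := h.d_eq (var j) (Finset.mem_map_of_mem _ (Finset.mem_univ _))
    rwa [toChain_d, hj, toChain_d] at this
  induction s generalizing n s' n' with
  | zero =>
    cases s' with
    | zero => exact ⟨rfl, fun j j' hj => ⟨hd j j' hj, by simp, fun i => i.elim0⟩⟩
    | succ s' =>
      cases n' with
      | zero => exact absurd T'.lt (Nat.not_lt_zero _)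
      | succ n' => exact h.elim
  | succ s ih =>
    cases n with
    | zero => exact absurd T.lt (Nat.not_lt_zero _)
    | succ n =>
    cases s' with
    | zero => exact h.elim
    | succ s' =>
    cases n' with
    | zero => exact absurd T'.lt (Nat.not_lt_zero _)
    | succ n' =>
      obtain ⟨-, h0, hf, ht⟩ := h
      have hV' : Finset.univ.map ((Fin.succEmb n).trans var) =
          Finset.univ.map ((Fin.succEmb n').trans var') := by
        rw [← map_univ_erase, ← map_univ_erase, hV, h0]
      rw [map_univ_erase] at ht
      have htd : ∀ (j : Fin n) (j' : Fin n'), var j.succ = var' j'.succ →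
          T.tail.d j = T'.tail.d j' := by
        intro j j' hj
        have := ht.d_eq (var j.succ) (Finset.mem_map_of_mem _ (Finset.mem_univ j))
        have e1 := T.tail.toChain_d ((Fin.succEmb n).trans var) j
        have e2 := T'.tail.toChain_d ((Fin.succEmb n').trans var') j'
        simp only [Function.Embedding.trans_apply, Fin.coe_succEmb] at e1 e2
        rwa [e1, hj, e2] at this
      obtain ⟨hs, hrec⟩ := ih hV' ht htd
      refine ⟨by rw [hs], fun j j' hj => ⟨hd j j' hj, ?_⟩⟩
      cases j using Fin.cases with
      | zero =>
        obtain rfl : j' = 0 := var'.injective (by rw [← hj, h0])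
        refine ⟨fun _ => rfl, fun i i' hi => ?_⟩
        cases i using Fin.cases with
        | zero =>
          obtain rfl : i' = 0 := Fin.ext hi.symm
          have := hd 0 0 hj
          have := T.α_le_d 0 0
          have := T'.α_le_d 0 0
          omega
        | succ i =>
          cases i' using Fin.cases with
          | zero => simp at hi
          | succ i' => rw [α_succ_zero, α_succ_zero]
      | succ j =>
        cases j' using Fin.cases with
        | zero => exact absurd (var.injective (hj.trans h0.symm)) (Fin.succ_ne_zero j)
        | succ j' =>
          obtain ⟨h1, h2, h3⟩ := hrec j j' hj
          refine ⟨fun hjs => by simpa using h2 (by simpa using hjs), fun i i' hi => ?_⟩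
          cases i using Fin.cases with
          | zero =>
            obtain rfl : i' = 0 := Fin.ext hi.symm
            have := hd _ _ hj
            have := T.α_le_d 0 j.succ
            have := T'.α_le_d 0 j'.succ
            simp only [tail] at h1
            omega
          | succ i =>
            cases i' using Fin.cases with
            | zero => simp at hi
            | succ i' => exact h3 i i' (by simpa using hi)

end

end Table

namespace LabelledTable

variable {σ : Type*}

/-- The variables of a labelled table. -/
def vars (A : LabelledTable σ) : Finset σ :=
  Finset.univ.map A.var

/-- The recursive form of a labelled table. -/
noncomputable def chain (A : LabelledTable σ) : TableChain σ :=
  A.table.toChain A.var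

variable [DecidableEq σ]

theorem same_of_eqv {A B : LabelledTable σ} (hV : A.vars = B.vars)
    (h : A.chain.Eqv A.vars B.chain) : A.Same B := by
  obtain ⟨hs, h⟩ := Table.eq_of_toChain_eqv hV h
  have hr : Set.range A.var = Set.range B.var := by
    ext t
    have : t ∈ A.vars ↔ t ∈ B.vars := by rw [hV]
    simpa [vars] using this
  let e : Fin A.n ≃ Fin B.n := (Equiv.ofInjective _ A.var.injective).trans
    ((Equiv.setCongr hr).trans (Equiv.ofInjective _ B.var.injective).symm)
  have he : ∀ j, A.var j = B.var (e j) := fun j => by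
    simp [e, Equiv.apply_ofInjective_symm]
  exact ⟨hs, e, fun j => (h j _ (he j)).2.1, fun j => (h j _ (he j)).1.symm,
    fun i j => ((h j _ (he j)).2.2 i _ rfl).symm, fun j => (he j).symm⟩

end LabelledTable

/-! ### Monomial ideals and sets of exponents -/

/-- The ideal generated by the monomials with exponents in `M`. -/
noncomputable def monomialIdeal (𝕜 : Type*) [Field 𝕜] {σ : Type*} (M : (σ → ℕ) → Prop) :
    Ideal (MvPolynomial σ 𝕜) :=
  Ideal.span ((fun u => MvPolynomial.monomial u (1 : 𝕜)) '' {u : σ →₀ ℕ | M u})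

section

variable {𝕜 : Type*} [Field 𝕜] {σ : Type*}

theorem monomial_mem_monomialIdeal_iff {M : (σ → ℕ) → Prop}
    (hM : ∀ u w : σ → ℕ, u ≤ w → M u → M w) (u : σ →₀ ℕ) :
    MvPolynomial.monomial u (1 : 𝕜) ∈ monomialIdeal 𝕜 M ↔ M u := by
  classical
  rw [monomialIdeal, MvPolynomial.mem_ideal_span_monomial_image,
    MvPolynomial.support_monomial, if_neg one_ne_zero]
  simp only [Finset.mem_singleton, forall_eq, Set.mem_ofPred_eq]
  exact ⟨fun ⟨w, hw, hle⟩ => hM w u hle hw, fun h => ⟨u, h, le_rfl⟩⟩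

theorem monomialIdeal_sup (M N : (σ → ℕ) → Prop) :
    monomialIdeal 𝕜 M ⊔ monomialIdeal 𝕜 N = monomialIdeal 𝕜 fun u => M u ∨ N u := by
  rw [monomialIdeal, monomialIdeal, ← Ideal.span_union, ← Set.image_union]
  rfl

end

/-! ### Ideals and normal forms of labelled tables -/

namespace LabelledTable

variable {σ : Type*}

@[simp]
theorem vars_single (d : ℕ) (v : σ) : (single d v).vars = {v} := rfl

theorem vars_nonempty (A : LabelledTable σ) : A.vars.Nonempty :=
  ⟨A.var ⟨0, (Nat.zero_le _).trans_lt A.table.lt⟩, Finset.mem_map_of_mem _ (Finset.mem_univ _)⟩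

theorem rename_gen (𝕜 : Type*) [Field 𝕜] (A : LabelledTable σ) (i : Fin (A.s + 1))
    (j : Fin A.n) :
    MvPolynomial.rename A.var (A.table.gen 𝕜 i j) =
      MvPolynomial.monomial (∑ t ∈ Finset.univ.filter (fun t : Fin A.n => (t : ℕ) < i ∨ t = j),
        Finsupp.single (A.var t) (A.table.expo i t)) 1 := by
  rw [Table.gen, map_prod, MvPolynomial.monomial_sum_one]
  refine Finset.prod_congr rfl fun t _ => ?_
  rw [map_pow, MvPolynomial.rename_X, MvPolynomial.X_pow_eq_monomial]

theorem isCons_chain (A : LabelledTable σ) : A.chain.IsCons ↔ 1 ≤ A.s :=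
  A.table.isCons_toChain A.var

theorem split_vars (A : LabelledTable σ) :
    A.split.bind (fun B => B.vars.val) = A.vars.val := by
  unfold split
  split_ifs
  · rw [Multiset.bind_map]
    simp only [vars_single, Finset.singleton_val, Multiset.bind_singleton]
    rfl
  · simp

variable {S S' : Multiset (LabelledTable σ)} {A B : LabelledTable σ}

theorem eq_of_mem_vars (hS : (S.bind fun A => A.vars.val).Nodup) (hA : A ∈ S) (hB : B ∈ S)
    {v : σ} (hvA : v ∈ A.vars) (hvB : v ∈ B.vars) : A = B := by
  obtain ⟨S, rfl⟩ := Multiset.exists_cons_of_mem hA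
  rw [Multiset.cons_bind, Multiset.nodup_add] at hS
  rcases Multiset.mem_cons.1 hB with h | h
  · exact h.symm
  · exact absurd (Multiset.mem_bind.2 ⟨B, h, hvB⟩) (Multiset.disjoint_left.1 hS.2.2 hvA)

/-- The variable sets in each family are nonempty and disjoint, so a table is determined by its set
and the matching is automatically bijective. -/
theorem rel_of_forall_exists {r : LabelledTable σ → LabelledTable σ → Prop}
    (hS : (S.bind fun A => A.vars.val).Nodup) (hS' : (S'.bind fun A => A.vars.val).Nodup)
    (h : ∀ A ∈ S, ∃ B ∈ S', A.vars = B.vars ∧ r A B)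
    (h' : ∀ B ∈ S', ∃ A ∈ S, A.vars = B.vars) : Multiset.Rel r S S' := by
  induction S using Multiset.induction generalizing S' with
  | empty =>
    obtain rfl : S' = 0 := Multiset.eq_zero_of_forall_notMem fun B hB => by
      obtain ⟨A, hA, -⟩ := h' B hB
      exact absurd hA (Multiset.notMem_zero A)
    exact Multiset.Rel.zero
  | cons A S ih =>
    obtain ⟨B, hB, hAB, hr⟩ := h A (Multiset.mem_cons_self A S)
    obtain ⟨S', rfl⟩ := Multiset.exists_cons_of_mem hB
    rw [Multiset.cons_bind, Multiset.nodup_add] at hS hS'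
    refine Multiset.Rel.cons hr (ih hS.2.1 hS'.2.1 (fun C hC => ?_) fun D hD => ?_)
    · obtain ⟨D, hD, hCD, hr⟩ := h C (Multiset.mem_cons_of_mem hC)
      rcases Multiset.mem_cons.1 hD with rfl | hD
      · obtain ⟨v, hv⟩ := C.vars_nonempty
        have hvA : v ∈ A.vars := by rwa [hAB, ← hCD]
        exact absurd (Multiset.mem_bind.2 ⟨C, hC, hv⟩) (Multiset.disjoint_left.1 hS.2.2 hvA)
      · exact ⟨D, hD, hCD, hr⟩
    · obtain ⟨C, hC, hCD⟩ := h' D (Multiset.mem_cons_of_mem hD)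
      rcases Multiset.mem_cons.1 hC with rfl | hC
      · obtain ⟨v, hv⟩ := D.vars_nonempty
        have hvB : v ∈ B.vars := by rwa [← hAB, hCD]
        exact absurd (Multiset.mem_bind.2 ⟨D, hD, hv⟩) (Multiset.disjoint_left.1 hS'.2.2 hvB)
      · exact ⟨C, hC, hCD⟩

variable [DecidableEq σ]

/-- The exponents of the monomials in the ideal of a labelled table. -/
def Mem (A : LabelledTable σ) (u : σ → ℕ) : Prop :=
  A.chain.Mem A.vars u

theorem valid (A : LabelledTable σ) : A.chain.Valid A.vars :=
  A.table.toChain_valid A.var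

theorem Mem.mono {A : LabelledTable σ} {u w : σ → ℕ} (h : u ≤ w) (hu : A.Mem u) : A.Mem w :=
  TableChain.Mem.congr A.valid hu fun t _ => h t

theorem ideal_eq (𝕜 : Type*) [Field 𝕜] (A : LabelledTable σ) :
    A.ideal 𝕜 = monomialIdeal 𝕜 A.Mem := by
  have hsum : ∀ (i : Fin (A.s + 1)) (j : Fin A.n) (r : Fin A.n), ((r : ℕ) < i ∨ r = j) →
      (∑ t ∈ Finset.univ.filter (fun t : Fin A.n => (t : ℕ) < i ∨ t = j), Finsupp.single (A.var t) (A.table.expo i t)) (A.var r) =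
        A.table.expo i r := by
    intro i j r hr
    rw [Finsupp.finsetSum_apply, Finset.sum_eq_single r]
    · simp
    · intro t _ htr
      simp [htr]
    · intro h
      simp [hr] at h
  rw [LabelledTable.ideal, Table.ideal, Ideal.map_span, monomialIdeal]
  apply le_antisymm
  · rw [Ideal.span_le]
    rintro _ ⟨_, ⟨i, j, hij, rfl⟩, rfl⟩
    refine Ideal.subset_span ⟨_, ?_, (A.rename_gen 𝕜 i j).symm⟩
    refine (A.table.toChain_mem_iff A.var _).2 ⟨i, j, hij, fun t ht => ?_⟩
    exact (hsum i j t ht).ge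
  · rw [Ideal.span_le]
    rintro _ ⟨u, hu, rfl⟩
    obtain ⟨i, j, hij, h⟩ := (A.table.toChain_mem_iff A.var u).1 hu
    have hle : ∑ t ∈ Finset.univ.filter (fun t : Fin A.n => (t : ℕ) < i ∨ t = j),
        Finsupp.single (A.var t) (A.table.expo i t) ≤ u := by
      intro r
      by_cases hr : ∃ t : Fin A.n, ((t : ℕ) < i ∨ t = j) ∧ A.var t = r
      · obtain ⟨t, ht, rfl⟩ := hr
        rw [hsum i j t ht]
        exact h t ht
      · rw [Finsupp.finsetSum_apply, Finset.sum_eq_zero]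
        · exact Nat.zero_le _
        · intro t ht
          have : A.var t ≠ r := fun e => hr ⟨t, (Finset.mem_filter.1 ht).2, e⟩
          simp [this]
    refine Ideal.mem_of_dvd _ (MvPolynomial.monomial_dvd_monomial.2 ⟨Or.inr hle, one_dvd 1⟩)
      (Ideal.subset_span ⟨_, ⟨i, j, hij, rfl⟩, A.rename_gen 𝕜 i j⟩)

theorem ideal_ne_top_iff (𝕜 : Type*) [Field 𝕜] (A : LabelledTable σ) :
    A.ideal 𝕜 ≠ ⊤ ↔ ¬ A.Mem 0 := by
  rw [Ne, Ideal.eq_top_iff_one, ideal_eq, not_iff_not]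
  exact monomial_mem_monomialIdeal_iff (fun _ _ h => Mem.mono h) 0

theorem mem_single_iff {d : ℕ} {v : σ} {u : σ → ℕ} : (single d v).Mem u ↔ d ≤ u v := by
  have h0 := (single d v).table.toChain_d (single d v).var
    (0 : Fin 1)
  have h1 : (single d v).Mem u ↔ ∃ t ∈ ({v} : Finset σ), (single d v).chain.d t ≤ u t := Iff.rfl
  rw [h1]
  simp only [Finset.mem_singleton, exists_eq_left]
  exact (iff_of_eq (congrArg (· ≤ u v) h0))

theorem isNormal_iff (𝕜 : Type*) [Field 𝕜] (A : LabelledTable σ) :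
    A.table.IsNormal 𝕜 ↔ A.chain.Reduced A.vars ∧
      (1 ≤ A.s → ∀ t ∈ A.vars, ¬ A.chain.IsZeroColumn t) := by
  have hcol : (1 ≤ A.s → ∀ t ∈ A.vars, ¬ A.chain.IsZeroColumn t) ↔
      (1 ≤ A.s → ∀ j : Fin A.n, A.s ≤ (j : ℕ) → ∃ i : Fin A.s, A.table.α i j ≠ 0) := by
    refine imp_congr_right fun _ => ?_
    simp only [vars, chain, Finset.mem_map, Finset.mem_univ, true_and, forall_exists_index,
      forall_apply_eq_imp_iff, Table.isZeroColumn_toChain_iff, not_and, not_forall]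
  have hred : A.chain.Reduced A.vars ↔ A.table.Reduced := A.table.toChain_reduced_iff A.var
  constructor
  · intro h
    refine ⟨hred.2 ⟨h.diag_ne_zero, fun j => ?_⟩, hcol.2 h.no_zero_column⟩
    by_cases hs : 1 ≤ A.s
    · exact h.no_singularity hs j
    -- For s = 0 positivity of the top row comes from properness: d_j = 0 would make the generator
    -- m_{0,j} equal to 1.
    · have : IsEmpty (Fin A.s) := ⟨fun i => hs (i.pos)⟩
      rw [Finset.univ_eq_empty, Finset.sum_empty]
      refine Nat.pos_of_ne_zero fun hd => h.proper ?_
      rw [Ideal.eq_top_iff_one, Table.ideal]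
      refine Ideal.subset_span ⟨0, j, Nat.zero_le _, ?_⟩
      simp [Table.gen, Table.expo_zero, Finset.filter_eq', hd]
  · rintro ⟨hr, hz⟩
    refine ⟨fun htop => ?_, (hred.1 hr).1, hcol.1 hz, fun _ => (hred.1 hr).2⟩
    refine (A.ideal_ne_top_iff 𝕜).2 (hr.not_mem_zero A.valid fun _ _ => rfl) ?_
    rw [LabelledTable.ideal, show A.table.ideal 𝕜 = ⊤ from htop, Ideal.map_top]

theorem exists_chain_eqv {V : Finset σ} {R : TableChain σ} (hv : R.Valid V) :
    ∃ A : LabelledTable σ, A.vars = V ∧ A.chain.Eqv V R := by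
  obtain ⟨s, n, T, var, hV, h⟩ := Table.exists_toChain_eqv hv
  exact ⟨⟨s, n, T, var⟩, hV, h⟩

theorem isNormal_single (𝕜 : Type*) [Field 𝕜] {d : ℕ} (v : σ) (hd : 0 < d) :
    (single d v).table.IsNormal 𝕜 := by
  rw [isNormal_iff]
  refine ⟨?_, fun h => absurd h (Nat.not_succ_le_zero 0)⟩
  exact ((single d v).table.toChain_reduced_iff _).2 ⟨fun i => i.elim0, fun _ => by
    exact (Finset.sum_eq_zero fun i _ => i.elim0).trans_lt hd⟩

/-- A proper table has the same ideal as a disjoint union of tables in normal form. -/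
theorem exists_normal (𝕜 : Type*) [Field 𝕜] (A : LabelledTable σ) (hA : ¬ A.Mem 0) :
    ∃ S : Multiset (LabelledTable σ), (∀ B ∈ S, B.table.IsNormal 𝕜) ∧
      S.bind (fun B => B.vars.val) = A.vars.val ∧ ∀ u, (∃ B ∈ S, B.Mem u) ↔ A.Mem u := by
  classical
  obtain ⟨R, hR, hmem, -, -, hred⟩ := TableChain.exists_reduced_or_base A.valid
  have hred : R.Reduced A.vars := by
    -- Properness excludes the unit ideal.
    refine hred.resolve_right ?_
    rintro ⟨d, rfl, t, ht, hd⟩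
    exact hA ((hmem 0).1 ⟨t, ht, hd.le⟩)
  by_cases hc : R.IsCons
  · let W := A.vars.filter fun t => ¬ R.IsZeroColumn t
    have hWV : W ⊆ A.vars := Finset.filter_subset _ _
    have hW : ∀ t ∈ A.vars, t ∉ W → R.IsZeroColumn t := fun t ht htW => by
      by_contra h
      exact htW (Finset.mem_filter.2 ⟨ht, h⟩)
    have hne : W.Nonempty := by
      cases R with
      | base d => exact hc.elim
      | cons d v f R => exact ⟨v, Finset.mem_filter.2 ⟨hR.1, fun h => h.1 rfl⟩⟩
    have hRW := hR.subset hred hWV hW hne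
    obtain ⟨B, hBW, hB⟩ := exists_chain_eqv hRW
    refine ⟨B ::ₘ (A.vars \ W).val.map fun t => single (R.d t) t, ?_, ?_, ?_⟩
    · intro C hC
      rcases Multiset.mem_cons.1 hC with rfl | hC
      · rw [isNormal_iff, hBW]
        have hv : C.chain.Valid W := hBW ▸ C.valid
        refine ⟨hB.reduced hv (hred.subset hWV), fun _ t ht hz => ?_⟩
        exact (Finset.mem_filter.1 ht).2 (hB.isZeroColumn ht hz)
      · obtain ⟨t, ht, rfl⟩ := Multiset.mem_map.1 hC
        exact isNormal_single 𝕜 t (hred.d_pos hR t (Finset.mem_sdiff.1 (show t ∈ A.vars \ W from ht)).1)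
    · rw [Multiset.cons_bind, Multiset.bind_map, hBW]
      simp only [vars_single, Finset.singleton_val]
      rw [Multiset.bind_singleton, Multiset.map_id', ← Finset.disjUnion_val _ _ Finset.disjoint_sdiff, Finset.disjUnion_eq_union,
        Finset.union_sdiff_of_subset hWV]
    · intro u
      have hBmem : B.Mem u ↔ R.Mem W u := by
        rw [Mem, hBW]
        exact hB.mem_iff (hBW ▸ B.valid)
      have hAmem : A.Mem u ↔ R.Mem A.vars u := (hmem u).symm
      rw [hAmem, TableChain.mem_iff_of_subset hR hWV hW, ← hBmem]
      simp only [Multiset.mem_cons, Multiset.mem_map, Finset.mem_val, or_and_right, exists_or,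
        exists_eq_left, exists_exists_and_eq_and, mem_single_iff]
  · obtain ⟨B, hBV, hB⟩ := exists_chain_eqv hR
    have hv : B.chain.Valid A.vars := hBV ▸ B.valid
    refine ⟨{B}, ?_, by simp [hBV], ?_⟩
    · simp only [Multiset.mem_singleton, forall_eq]
      rw [isNormal_iff, hBV]
      refine ⟨hB.reduced hv hred, fun hs => absurd ?_ hc⟩
      have hBc := B.isCons_chain.2 hs
      revert hB hBc
      cases B.chain <;> cases R <;> intro h1 h2
      · exact h2
      · trivial
      · exact h1
      · trivial
    · intro u
      simp only [Multiset.mem_singleton, exists_eq_left]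
      rw [Mem, hBV]
      exact (hB.mem_iff hv).trans (hmem u)

/-! ### Disjoint unions of tables -/

theorem sum_ideal_eq (𝕜 : Type*) [Field 𝕜] (S : Multiset (LabelledTable σ)) :
    (S.map (LabelledTable.ideal 𝕜)).sum = monomialIdeal 𝕜 fun u => ∃ A ∈ S, A.Mem u := by
  induction S using Multiset.induction with
  | empty => simp [monomialIdeal]
  | cons A S ih =>
    rw [Multiset.map_cons, Multiset.sum_cons, ih, ideal_eq, ← Ideal.add_eq_sup.symm,
      monomialIdeal_sup]
    simp

/-- The tables are either single columns or have a constrained column and no zero column. -/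
def Irreducible (A : LabelledTable σ) : Prop :=
  A.chain.Reduced A.vars ∧
    ((∃ v, A.vars = {v}) ∨ A.chain.IsCons ∧ ∀ t ∈ A.vars, ¬ A.chain.IsZeroColumn t)

/-- A monomial supported on the variables of A is constant for every other table, and those have
proper ideals. -/
theorem mem_of_exists_mem (hS : (S.bind fun A => A.vars.val).Nodup)
    (hr : ∀ A ∈ S, A.Irreducible) (hA : A ∈ S) {u : σ → ℕ} (hu : ∀ t ∉ A.vars, u t = 0)
    (h : ∃ B ∈ S, B.Mem u) : A.Mem u := by
  obtain ⟨B, hB, h⟩ := h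
  by_cases e : B = A
  · exact e ▸ h
  · refine absurd h ((hr B hB).1.not_mem_zero B.valid fun t ht => hu t fun htA => e ?_)
    exact eq_of_mem_vars hS hB hA ht htA

theorem exists_vars_subset (hS : (S.bind fun A => A.vars.val).Nodup)
    (hS' : (S'.bind fun A => A.vars.val).Nodup) (hr : ∀ A ∈ S, A.Irreducible)
    (hcover : ∀ v, ∃ B ∈ S', v ∈ B.vars)
    (h : ∀ u, (∃ A ∈ S, A.Mem u) ↔ ∃ A ∈ S', A.Mem u) (hA : A ∈ S) :
    ∃ B ∈ S', A.vars ⊆ B.vars := by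
  obtain ⟨hred, ⟨v, hv⟩ | ⟨hc, hz⟩⟩ := hr A hA
  · obtain ⟨B, hB, hvB⟩ := hcover v
    exact ⟨B, hB, by simpa [hv] using hvB⟩
  -- The first constrained variable divides every mixed monomial. It serves as an anchor: the table
  -- of S' containing it will contain all of A.
  obtain ⟨v, hvA, hv⟩ : ∃ v ∈ A.vars, ∀ u, (∀ t ∈ A.vars, u t < A.chain.d t) →
      ¬ A.Mem (Function.update u v 0) := by
    have hvalid := A.valid
    unfold Mem
    revert hvalid hred hc
    cases A.chain with
    | base d => exact fun _ hc _ => hc.elim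
    | cons d v f R =>
      refine fun hred _ hvalid => ⟨v, hvalid.1, fun u hlt hmem => ?_⟩
      have := TableChain.le_of_mem_of_lt hmem fun t ht => by
        by_cases e : t = v
        · subst e
          simpa using hred.1.trans hred.2.1
        · simpa [e] using hlt t ht
      have := hred.1
      simp at *
      omega
  obtain ⟨B, hB, hvB⟩ := hcover v
  refine ⟨B, hB, fun t ht => ?_⟩
  obtain ⟨u, hu, hlt, hut⟩ := TableChain.exists_mixed_of_not_isZeroColumn A.valid hred hc ht
    (hz t ht)
  let w : σ → ℕ := fun r => if r ∈ A.vars then u r else 0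
  have hwu : ∀ r ∈ A.vars, w r = u r := fun r hrA => if_pos hrA
  have hw : A.Mem w := TableChain.Mem.congr A.valid hu fun r hrA => (hwu r hrA).ge
  obtain ⟨C, hC, hCw⟩ := (h w).1 ⟨A, hA, hw⟩
  -- If x were not a variable of C, setting its exponent to 0 would keep the monomial in the ideal
  -- of C, hence in that of A. Applied to v and t, this puts both in C.
  have key : ∀ x, ¬ A.Mem (Function.update u x 0) → x ∈ C.vars := by
    intro x hx
    by_contra hxC
    rw [Mem, ← TableChain.mem_update_iff (v := x) (k := 0) C.valid hxC] at hCw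
    have hmem := mem_of_exists_mem hS hr hA (fun r hrA => ?_) ((h _).2 ⟨C, hC, hCw⟩)
    · refine hx (TableChain.Mem.congr A.valid hmem fun r hrA => ?_)
      by_cases e : r = x
      · simp [e]
      · simp [e, hwu r hrA]
    · by_cases e : r = x
      · simp [e]
      · simp [e, w, hrA]
  rw [eq_of_mem_vars hS' hB hC hvB (key v (hv u hlt))]
  exact key t hut

theorem exists_same (hS : (S.bind fun A => A.vars.val).Nodup)
    (hS' : (S'.bind fun A => A.vars.val).Nodup) (hr : ∀ A ∈ S, A.Irreducible)
    (hr' : ∀ A ∈ S', A.Irreducible)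
    (hcover : ∀ v, ∃ B ∈ S, v ∈ B.vars) (hcover' : ∀ v, ∃ B ∈ S', v ∈ B.vars)
    (h : ∀ u, (∃ A ∈ S, A.Mem u) ↔ ∃ A ∈ S', A.Mem u) (hA : A ∈ S) :
    ∃ B ∈ S', A.vars = B.vars ∧ A.chain.Eqv A.vars B.chain := by
  obtain ⟨B, hB, hAB⟩ := exists_vars_subset hS hS' hr hcover' h hA
  obtain ⟨C, hC, hBC⟩ := exists_vars_subset hS' hS hr' hcover (fun u => (h u).symm) hB
  obtain ⟨v, hv⟩ := A.vars_nonempty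
  obtain rfl := eq_of_mem_vars hS hA hC hv (hBC (hAB hv))
  have hV := hAB.antisymm hBC
  refine ⟨B, hB, hV, ?_⟩
  have hvB : B.chain.Valid A.vars := hV ▸ B.valid
  have hrB : B.chain.Reduced A.vars := hV ▸ (hr' B hB).1
  refine TableChain.eqv_of_mem_iff A.valid (hr A hA).1 hvB hrB fun u => ?_
  -- Truncation to the variables of A: on such monomials both sums of ideals reduce to the single
  -- tables A and B.
  let w : σ → ℕ := fun r => if r ∈ A.vars then u r else 0
  have hwu : ∀ r ∈ A.vars, w r = u r := fun r hrA => if_pos hrA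
  have hw0 : ∀ r ∉ A.vars, w r = 0 := fun r hrA => if_neg hrA
  have hBw : B.Mem w ↔ B.chain.Mem A.vars w := by rw [Mem, hV]
  constructor
  · intro hu
    have hw : A.Mem w := TableChain.Mem.congr A.valid hu fun r hrA => (hwu r hrA).ge
    have := mem_of_exists_mem hS' hr' hB (fun r hrB => hw0 r (hV ▸ hrB)) ((h w).1 ⟨A, hA, hw⟩)
    exact TableChain.Mem.congr hvB (hBw.1 this) fun r hrA => (hwu r hrA).le
  · intro hu
    have hw : B.Mem w :=
      hBw.2 (TableChain.Mem.congr hvB hu fun r hrA => (hwu r hrA).ge)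
    have := mem_of_exists_mem hS hr hA hw0 ((h w).2 ⟨B, hB, hw⟩)
    exact TableChain.Mem.congr A.valid this fun r hrA => (hwu r hrA).le

theorem split_mem (A : LabelledTable σ) (u : σ → ℕ) : (∃ B ∈ A.split, B.Mem u) ↔ A.Mem u := by
  unfold split
  split_ifs with hs
  · simp only [Multiset.mem_map, Finset.mem_val, Finset.mem_univ, true_and,
      exists_exists_eq_and, mem_single_iff]
    obtain ⟨s, n, T, var⟩ := A
    obtain rfl : s = 0 := hs
    simp [Mem, chain, vars, Table.toChain, TableChain.Mem, var.injective.extend_apply]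
  · simp

theorem irreducible_of_mem_split {𝕜 : Type*} [Field 𝕜] (hA : A.table.IsNormal 𝕜)
    (hB : B ∈ A.split) : B.Irreducible := by
  unfold split at hB
  rw [isNormal_iff] at hA
  split_ifs at hB with hs
  · obtain ⟨j, -, rfl⟩ := Multiset.mem_map.1 hB
    have hpos := hA.1.d_pos A.valid (A.var j) (Finset.mem_map_of_mem _ (Finset.mem_univ j))
    rw [chain, A.table.toChain_d] at hpos
    exact ⟨((isNormal_iff 𝕜 _).1 (isNormal_single 𝕜 (A.var j) hpos)).1, Or.inl ⟨_, rfl⟩⟩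
  · obtain rfl := Multiset.mem_singleton.1 hB
    have hs' : 1 ≤ B.s := Nat.one_le_iff_ne_zero.2 hs
    exact ⟨hA.1, Or.inr ⟨B.isCons_chain.2 hs', hA.2 hs'⟩⟩

theorem exists_normal_multiset (𝕜 : Type*) [Field 𝕜] (S : Multiset (LabelledTable σ))
    (hS : ∀ A ∈ S, ¬ A.Mem 0) :
    ∃ S' : Multiset (LabelledTable σ), (∀ B ∈ S', B.table.IsNormal 𝕜) ∧
      S'.bind (fun B => B.vars.val) = S.bind (fun B => B.vars.val) ∧
      ∀ u, (∃ B ∈ S', B.Mem u) ↔ ∃ B ∈ S, B.Mem u := by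
  induction S using Multiset.induction with
  | empty => exact ⟨0, by simp, rfl, fun _ => Iff.rfl⟩
  | cons A S ih =>
    obtain ⟨S₁, h1, h2, h3⟩ := exists_normal 𝕜 A (hS A (Multiset.mem_cons_self A S))
    obtain ⟨S₂, h4, h5, h6⟩ := ih fun B hB => hS B (Multiset.mem_cons_of_mem hB)
    refine ⟨S₁ + S₂, fun B hB => (Multiset.mem_add.1 hB).elim (h1 B) (h4 B), ?_, fun u => ?_⟩
    · rw [Multiset.add_bind, h2, h5, Multiset.cons_bind]
    · simp only [Multiset.mem_add, Multiset.mem_cons, or_and_right, exists_or, h3, h6,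
        exists_eq_left]

end LabelledTable

/-! ### The theorem for generalised tables -/

namespace GenTable

variable {𝕜 : Type*} [Field 𝕜] {σ : Type*} [Fintype σ]

theorem components_vars (T : GenTable σ) :
    T.components.bind (fun A => A.vars.val) = Finset.univ.val := by
  rw [components, Multiset.bind_assoc]
  simp only [LabelledTable.split_vars]
  exact T.partition

variable [DecidableEq σ]

theorem ideal_eq (T : GenTable σ) :
    T.ideal 𝕜 = monomialIdeal 𝕜 fun u => ∃ A ∈ T.tables, A.Mem u :=
  LabelledTable.sum_ideal_eq 𝕜 T.tables

theorem monomial_mem_ideal_iff (T : GenTable σ) (u : σ →₀ ℕ) :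
    MvPolynomial.monomial u (1 : 𝕜) ∈ T.ideal 𝕜 ↔ ∃ A ∈ T.tables, A.Mem u := by
  rw [ideal_eq]
  exact monomial_mem_monomialIdeal_iff (fun _ _ h ⟨A, hA, hu⟩ => ⟨A, hA, hu.mono h⟩) u

theorem components_mem (T : GenTable σ) (u : σ → ℕ) :
    (∃ A ∈ T.components, A.Mem u) ↔ ∃ A ∈ T.tables, A.Mem u := by
  simp only [components, Multiset.mem_bind]
  constructor
  · rintro ⟨B, ⟨A, hA, hB⟩, h⟩
    exact ⟨A, hA, (A.split_mem u).1 ⟨B, hB, h⟩⟩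
  · rintro ⟨A, hA, h⟩
    obtain ⟨B, hB, h⟩ := (A.split_mem u).2 h
    exact ⟨B, ⟨A, hA, hB⟩, h⟩

/-- A generalised table in normal form is determined by its ideal. -/
theorem same_of_ideal_eq {T T' : GenTable σ} (hT : T.IsNormal 𝕜) (hT' : T'.IsNormal 𝕜)
    (h : T.ideal 𝕜 = T'.ideal 𝕜) : T.Same T' := by
  have hirr : ∀ {T : GenTable σ}, T.IsNormal 𝕜 → ∀ A ∈ T.components, A.Irreducible := by
    intro T hT A hA
    obtain ⟨B, hB, hA⟩ := Multiset.mem_bind.1 hA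
    exact LabelledTable.irreducible_of_mem_split (hT.2 B hB) hA
  have hnodup : ∀ T : GenTable σ, (T.components.bind fun A => A.vars.val).Nodup := fun T =>
    T.components_vars ▸ Finset.univ.nodup
  have hcover : ∀ (T : GenTable σ) (v : σ), ∃ A ∈ T.components, v ∈ A.vars := fun T v => by
    have : v ∈ T.components.bind fun A => A.vars.val := T.components_vars ▸ Finset.mem_univ v
    exact Multiset.mem_bind.1 this
  have hmem : ∀ u, (∃ A ∈ T.components, A.Mem u) ↔ ∃ A ∈ T'.components, A.Mem u := by
    intro u
    obtain ⟨w, rfl⟩ := Finsupp.equivFunOnFinite.surjective u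
    rw [components_mem, components_mem]
    have h1 := T.monomial_mem_ideal_iff (𝕜 := 𝕜) w
    have h2 := T'.monomial_mem_ideal_iff (𝕜 := 𝕜) w
    rw [h] at h1
    exact h1.symm.trans h2
  refine LabelledTable.rel_of_forall_exists (hnodup T) (hnodup T') (fun A hA => ?_)
    fun B hB => ?_
  · obtain ⟨B, hB, hV, hAB⟩ := LabelledTable.exists_same (hnodup T) (hnodup T') (hirr hT)
      (hirr hT') (hcover T) (hcover T') hmem hA
    exact ⟨B, hB, hV, LabelledTable.same_of_eqv hV hAB⟩
  · obtain ⟨A, hA, hV, -⟩ := LabelledTable.exists_same (hnodup T') (hnodup T) (hirr hT')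
      (hirr hT) (hcover T') (hcover T) (fun u => (hmem u).symm) hB
    exact ⟨A, hA, hV.symm⟩

theorem exists_isNormal (T : GenTable σ) (hT : T.IsProper 𝕜) :
    ∃ T' : GenTable σ, T'.IsNormal 𝕜 ∧ T'.ideal 𝕜 = T.ideal 𝕜 := by
  obtain ⟨S, h1, h2, h3⟩ := LabelledTable.exists_normal_multiset 𝕜 T.tables fun A hA h => by
    refine hT ((Ideal.eq_top_iff_one _).2 ?_)
    exact (T.monomial_mem_ideal_iff 0).2 ⟨A, hA, h⟩
  let T' : GenTable σ := ⟨S, h2.trans T.partition⟩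
  have h : T'.ideal 𝕜 = T.ideal 𝕜 := by
    rw [ideal_eq, ideal_eq]
    exact congrArg _ (funext fun u => propext (h3 u))
  exact ⟨T', ⟨fun e => hT (h.symm.trans e), h1⟩, h⟩

end GenTable

theorem mainTheorem1 {𝕜 : Type*} [Field 𝕜] (n : ℕ) (K : Ideal (MvPolynomial (Fin n) 𝕜))
    (hK : IsTableIdeal K) (hproper : K ≠ ⊤) :
    ∃ T : GenTable (Fin n), T.IsNormal 𝕜 ∧ T.ideal 𝕜 = K ∧
      ∀ T' : GenTable (Fin n), T'.IsNormal 𝕜 → T'.ideal 𝕜 = K → T'.Same T := by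
  obtain ⟨T₀, rfl⟩ := hK
  obtain ⟨T, hT, h⟩ := T₀.exists_isNormal hproper
  exact ⟨T, hT, h, fun T' hT' h' => GenTable.same_of_ideal_eq hT' hT (h'.trans h.symm)⟩
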